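/- **Conventions.** Let $\mathbf C$ be a finitely complete category and $\pi\colon\widetilde{\mathcal U}\to\mathcal U$ a *universal map*: an exponentiable map with chosen pullbacks along it. A *fibrancy structure* on $p\colon E\to B$ is a pullback square exhibiting $p$ as a pullback of $\pi$ along a map $B\to\mathcal U$; $p$ is a *$\pi$-fibration* if it has one. An *internal universe* of $\pi$ is a universal map $\pi^{\mathsf{ds}}\colon\widetilde{\mathcal U}^{\mathsf{ds}}\to\mathcal U^{\mathsf{ds}}$ such that $\pi^{\mathsf{ds}}$ and $\mathcal U^{\mathsf{ds}}\to 1$ are equipped with $\pi$-fibrancy structures. For $s\colon Y\to E$ and $e\colon E\to B$, a *lifting structure* $s\pitchfork_B(B\times p)$ against $p\colon X\to Z$ assigns to every base change $s'\colon Y'\to E'$ of $s$ along a map $B'\to B$ and every commutative square from $s'$ to $p$ a diagonal filler, naturally in $B'$. An *$\mathrm{Id}$-type structure* on $\pi$ consists of maps $\mathrm{Id}\colon\widetilde{\mathcal U}\times_{\mathcal U}\widetilde{\mathcal U}\to\mathcal U$ and $\mathrm{rn}\colon\widetilde{\mathcal U}\to\widetilde{\mathcal U}$ with $\pi\circ\mathrm{rn}=\mathrm{Id}\circ\Delta$,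 together with, for the induced factorisation $\widetilde{\mathcal U}\xrightarrow{\mathrm{refl}}\mathrm{Id}^*\widetilde{\mathcal U}\xrightarrow{\mathrm{ev}_\partial}\widetilde{\mathcal U}\times_{\mathcal U}\widetilde{\mathcal U}$ of the diagonal, a lifting structure $J\in\mathrm{refl}\pitchfork_{\mathcal U}(\mathcal U\times\pi)$. Given a fibrancy structure on $p\colon E\to B$, pulling back gives $E\xrightarrow{\mathrm{refl}}\mathrm{Id}_B(E)\xrightarrow{\mathrm{ev}_\partial}E\times_BE$. $\mathrm{Unit}$-, $\Sigma$- and $\Pi$-type structures are $\pi$-fibrancy structures on $\mathrm{id}_1$, on the generic composite $\mathrm{GenComp}(\pi,\pi)$, and on $\mathbf P_\pi(\pi)$; here $\mathbf P_f$ is the polynomial functor of an exponentiable map $f\colon E\to B$ and $\mathrm{GenComp}(q,f)$, for $q\colon Y\to X$, is the composite $E\times_B\mathbf P_f(X)\times_XY\to E\times_B\mathbf P_f(X)\to\mathbf P_f(X)$. **Setting.** Let $\mathbf C_0,\mathbf C_1$ be finitely complete categories and $M\colon\mathbf C_0\to\mathbf C_1$ a finite-limit-preserving functor. For $i=0,1$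 let $\pi_i$ be a universal map in $\mathbf C_i$ with an internal universe $\pi_i^{\mathsf{ds}}$, all four with $\mathrm{Unit}$-, $\Sigma$-, $\Pi$- and $\mathrm{Id}$-type structures. Assume (1) $M$ sends $\pi_0$-fibrations to $\pi_1$-fibrations; and (2) for all $Y_0\xrightarrow{s_0}E_0\to B_0$ such that $E_0\to B_0$ and $Y_0\to B_0$ are $\pi_0$-fibrations, there is a map $(s_0\pitchfork_{B_0}(B_0\times\pi_0))\to(Ms_0\pitchfork_{MB_0}(MB_0\times\pi_1))$, compatible with base change. $\mathrm{Gl}(M)$ is the category of maps $X_1\to MX_0$ in $\mathbf C_1$. For $f\colon Y\to X$ in it, put $\widehat M_X(Y)=X_1\times_{MX_0}MY_0$; the induced map $Y_1\to\widehat M_X(Y)$ is the relative matching map, and $f$ is a *Reedy fibration* if $f_0$ is a $\pi_0$-fibration and its relative matching map is a $\pi_1$-fibration. *Internal Reedy fibrations* are defined likewise from $\pi_0^{\mathsf{ds}},\pi_1^{\mathsf{ds}}$. Let $\tau$ be the map of $\mathrm{Gl}(M)$ with $\tau_0=\pi_0$ and $\tau_1=\mathrm{GenComp}(\pi_1,M\pi_0)$,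 over the base $\mathbf P_{M\pi_0}(\mathcal U_1)\to M\mathcal U_0$; define $\tau^{\mathsf{ds}}$ likewise. **Theorem.** $M\pi_0$ is exponentiable, and for every choice of the pushforward along it and of pullbacks along $\tau$ the following hold. (A) The diagonal of each Reedy fibration $p\colon E\to B$, with given fibrancy structures on $p_0$ and on its relative matching map, has a factorisation $E\xrightarrow{\mathrm{refl}}I\xrightarrow{\mathrm{ev}_\partial}E\times_BE$ such that: 1. $\mathrm{ev}_\partial$ is a Reedy fibration. 2. The iterated pullback of the relative matching map $I_1\to\widehat M_{E\times_BE}(I)\to\widehat M_B(I)$ along $\widehat M_B(\mathrm{refl})\colon\widehat M_B(E)\to\widehat M_B(I)$ is $\mathrm{Id}_{\widehat M_B(E)}(E_1)\xrightarrow{\mathrm{ev}_\partial}E_1\times_{\widehat M_B(E)}E_1\to\widehat M_B(E)$. 3. There is a lifting structure $\mathrm{refl}\pitchfork_B(B\times\tau)$. 4. The $0$-component of the factorisation is isomorphic to $E_0\to\mathrm{Id}_{B_0}(E_0)\to E_0\times_{B_0}E_0$. The $1$-component is as follows. Let $P,Q\to\widehat M_B(I)$ be the pullbacks of $E_1\to\widehat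 M_B(E)$ along the two maps $\widehat M_B(I)\rightrightarrows\widehat M_B(E)$ induced by $I\to E\times_BE\rightrightarrows E$. There is a transport map $P\to Q$ over $\widehat M_B(I)$, restricting to $\mathrm{id}_{E_1}$ along $\widehat M_B(\mathrm{refl})$, such that $I_1\to\widehat M_{E\times_BE}(I)$ is the pullback of $\mathrm{ev}_\partial\colon\mathrm{Id}_{\widehat M_B(I)}(Q)\to Q\times_{\widehat M_B(I)}Q$ along the map whose components are $\widehat M_{E\times_BE}(I)\to P\xrightarrow{\text{transport}}Q$ and $\widehat M_{E\times_BE}(I)\to Q$. Further, $\mathrm{refl}_1$ is $E_1\xrightarrow{\mathrm{refl}}\mathrm{Id}_{\widehat M_B(E)}(E_1)\to I_1$, the second map being that of 2. (B) $\tau$ has an $\mathrm{Id}$-type structure which the projection $\mathrm{Gl}(M)\to\mathbf C_0$ sends to the given one of $\pi_0$ (formation map, reflexivity map and $J$-structure), and whose factorisation of the diagonal of $\tau$ is of the form described in 1, 2 and 4. If moreover (2) also holds with $\pi_0^{\mathsf{ds}},\pi_1^{\mathsf{ds}}$ in place of $\pi_0,\pi_1$, then the same assertions hold for internal Reedy fibrations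 and $\tau^{\mathsf{ds}}$, with $\pi_i^{\mathsf{ds}}$ and $\tau^{\mathsf{ds}}$ in place of $\pi_i$ and $\tau$ throughout. -/

import Mathlib

open CategoryTheory CategoryTheory.Limits

namespace GlueId

set_option linter.unusedSectionVars false

universe v u v₀ u₀ v₁ u₁

section UniverseCategories

variable {C : Type u} [Category.{v} C]

/-! ### Exponentiable maps, generic composites, universal maps -/

/-- A choice of pullbacks along `f` (a right adjoint of post-composition with `f`) together with
a choice of pushforward along `f` (a right adjoint of the pullback functor). -/
structure ExpStr {E B : C} (f : E ⟶ B) where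
  chosen : ChosenPullbacksAlong f
  expo : ExponentiableMorphism f

namespace ExpStr

variable [HasFiniteLimits C] {E B : C} {f : E ⟶ B} (e : ExpStr f)

/-- The pushforward `f_*(E × X)`, an object over `B`; its domain is the value at `X` of the
polynomial functor associated with `f`. -/
noncomputable def polyObj (X : C) : Over B :=
  letI := e.chosen
  letI := e.expo
  (ExponentiableMorphism.pushforward f).obj (Over.mk (prod.fst : E ⨯ X ⟶ E))

/-- The pullback `f^* f_*(E × X)`, an object over `E`. -/
noncomputable def polyTot (X : C) : Over E :=
  letI := e.chosen
  (ChosenPullbacksAlong.pullback f).obj (e.polyObj X)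

/-- The projection `f^* f_*(E × X) ⟶ f_*(E × X)`. -/
noncomputable def polyProj (X : C) : (e.polyTot X).left ⟶ (e.polyObj X).left :=
  letI := e.chosen
  ((ChosenPullbacksAlong.mapPullbackAdj f).counit.app (e.polyObj X)).left

/-- The evaluation `f^* f_*(E × X) ⟶ E × X ⟶ X`. -/
noncomputable def polyEv (X : C) : (e.polyTot X).left ⟶ X :=
  letI := e.chosen
  letI := e.expo
  ((ExponentiableMorphism.pullbackPushforwardAdj f).counit.app
    (Over.mk (prod.fst : E ⨯ X ⟶ E))).left ≫ prod.snd

/-- The action `f_*(E × X) ⟶ f_*(E × Y)` of the polynomial functor on a map `k : X ⟶ Y`. -/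
noncomputable def polyMap {X Y : C} (k : X ⟶ Y) : (e.polyObj X).left ⟶ (e.polyObj Y).left :=
  letI := e.chosen
  letI := e.expo
  ((ExponentiableMorphism.pushforward f).map
    (Over.homMk (prod.map (𝟙 E) k) : Over.mk (prod.fst : E ⨯ X ⟶ E) ⟶
      Over.mk (prod.fst : E ⨯ Y ⟶ E))).left

/-- The generic composite of `q : Y ⟶ X` and `f`: the pullback of `q` along the evaluation
`f^* f_*(E × X) ⟶ X`, followed by the projection to `f_*(E × X)`. -/
noncomputable def genComp {X Y : C} (q : Y ⟶ X) :
    pullback (e.polyEv X) q ⟶ (e.polyObj X).left :=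
  pullback.fst (e.polyEv X) q ≫ e.polyProj X

lemma isPullback_poly (X : C) :
    IsPullback (e.polyProj X) (e.polyTot X).hom (e.polyObj X).hom f :=
  letI := e.chosen
  ChosenPullbacksAlong.isPullback (e.polyObj X).hom f

end ExpStr

/-- A fibrancy structure for `p : E ⟶ B` with respect to `π`: a name and a point exhibiting `p`
as a pullback of `π`. -/
structure FibStr {T U E B : C} (π : T ⟶ U) (p : E ⟶ B) where
  name : B ⟶ U
  point : E ⟶ T
  isPullback : IsPullback point p π name

/-- `p` is a `π`-fibration. -/
def IsFib {T U E B : C} (π : T ⟶ U) (p : E ⟶ B) : Prop := Nonempty (FibStr π p)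

/-- The tautological fibrancy structure of `π`. -/
def FibStr.self {T U : C} (π : T ⟶ U) : FibStr π π where
  name := 𝟙 U
  point := 𝟙 T
  isPullback := IsPullback.id_horiz π

/-- The pulled back fibrancy structure. -/
def FibStr.pull {T U E B E' B' : C} {π : T ⟶ U} {p : E ⟶ B} (F : FibStr π p)
    {k : E' ⟶ E} {q : E' ⟶ B'} {f : B' ⟶ B} (h : IsPullback k q p f) : FibStr π q where
  name := f ≫ F.name
  point := k ≫ F.point
  isPullback := h.paste_horiz F.isPullback

variable (C) in
/-- A universal map: an exponentiable map with a choice of pullbacks along it. -/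
structure UniversalMap where
  T : C
  U : C
  π : T ⟶ U
  str : ExpStr π

instance (w : UniversalMap C) : ChosenPullbacksAlong w.π := w.str.chosen

/-- An internal (fibrant) universe of a universal map. -/
structure InternalUniverse [HasFiniteLimits C] (w : UniversalMap C) extends UniversalMap C where
  fibMap : FibStr w.π π
  fibObj : FibStr w.π (terminal.from U)

/-! ### Lifting structures in slices -/

/-- For maps `s : Y ⟶ E` and `e : E ⟶ B`, a base change of `s`, regarded as a map over `B`,
along a map `f : B' ⟶ B`. -/
structure BaseChange {Y E B : C} (s : Y ⟶ E) (e : E ⟶ B) where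
  B' : C
  E' : C
  Y' : C
  f : B' ⟶ B
  e' : E' ⟶ B'
  s' : Y' ⟶ E'
  g : E' ⟶ E
  h : Y' ⟶ Y
  isPullback_e : IsPullback g e' e f
  isPullback_s : IsPullback h s' s g

/-- A map between base changes of the same map over `B`, lying over a map `t` of bases over
`B`. -/
structure BaseChange.Hom {Y E B : C} {s : Y ⟶ E} {e : E ⟶ B} (c d : BaseChange s e) where
  t : c.B' ⟶ d.B'
  k : c.E' ⟶ d.E'
  l : c.Y' ⟶ d.Y'
  t_f : t ≫ d.f = c.f
  k_g : k ≫ d.g = c.g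
  l_h : l ≫ d.h = c.h
  k_e : k ≫ d.e' = c.e' ≫ t
  l_s : l ≫ d.s' = c.s' ≫ k

/-- A (stable, uniform) lifting structure, in the slice over `B`, of `s : Y ⟶ E` against
`B × p : B × X ⟶ B × Z`.  Lifting problems of a base change `s' : Y' ⟶ E'` along `B' ⟶ B` against
`B × p` over `B` are the same as squares from `s'` to `p`; each of them is assigned a diagonal
filler, naturally in `B'`. -/
@[ext]
structure LiftStr {Y E B X Z : C} (s : Y ⟶ E) (e : E ⟶ B) (p : X ⟶ Z) where
  fill (c : BaseChange s e) (a : c.Y' ⟶ X) (b : c.E' ⟶ Z) (w : a ≫ p = c.s' ≫ b) : c.E' ⟶ X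
  fill_left (c : BaseChange s e) (a : c.Y' ⟶ X) (b : c.E' ⟶ Z) (w : a ≫ p = c.s' ≫ b) :
    c.s' ≫ fill c a b w = a
  fill_right (c : BaseChange s e) (a : c.Y' ⟶ X) (b : c.E' ⟶ Z) (w : a ≫ p = c.s' ≫ b) :
    fill c a b w ≫ p = b
  natural {c d : BaseChange s e} (φ : c.Hom d) (a : d.Y' ⟶ X) (b : d.E' ⟶ Z)
    (w : a ≫ p = d.s' ≫ b) :
    fill c (φ.l ≫ a) (φ.k ≫ b) (by rw [Category.assoc, w, reassoc_of% φ.l_s]) =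
      φ.k ≫ fill d a b w

/-- Base changes compose. -/
def BaseChange.trans {Y E B : C} {s : Y ⟶ E} {e : E ⟶ B} (c : BaseChange s e)
    (d : BaseChange c.s' c.e') : BaseChange s e where
  B' := d.B'
  E' := d.E'
  Y' := d.Y'
  f := d.f ≫ c.f
  e' := d.e'
  s' := d.s'
  g := d.g ≫ c.g
  h := d.h ≫ c.h
  isPullback_e := d.isPullback_e.paste_horiz c.isPullback_e
  isPullback_s := d.isPullback_s.paste_horiz c.isPullback_s

/-- The base change of a lifting structure over `B` to a lifting structure over `B'`. -/
def LiftStr.restrict {Y E B X Z : C} {s : Y ⟶ E} {e : E ⟶ B} {p : X ⟶ Z} (L : LiftStr s e p)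
    (c : BaseChange s e) : LiftStr c.s' c.e' p where
  fill d a b w := L.fill (c.trans d) a b w
  fill_left d a b w := L.fill_left (c.trans d) a b w
  fill_right d a b w := L.fill_right (c.trans d) a b w
  natural {d d'} φ a b w :=
    L.natural (c := c.trans d) (d := c.trans d')
      { t := φ.t, k := φ.k, l := φ.l
        t_f := by simp [BaseChange.trans, reassoc_of% φ.t_f]
        k_g := by simp [BaseChange.trans, reassoc_of% φ.k_g]
        l_h := by simp [BaseChange.trans, reassoc_of% φ.l_h]
        k_e := φ.k_e
        l_s := φ.l_s } a b w

/-! ### Identity types -/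

/-- A pre-`Id`-type structure. -/
structure PreIdStr [HasFiniteLimits C] {T U : C} (π : T ⟶ U) where
  Id : pullback π π ⟶ U
  reflName : T ⟶ T
  comm : reflName ≫ π = pullback.diagonal π ≫ Id

namespace PreIdStr

variable [HasFiniteLimits C] {T U : C} {π : T ⟶ U} [ChosenPullbacksAlong π] (S : PreIdStr π)

/-- `Id_U(T)`: the selected pullback of `π` along `Id`. -/
noncomputable def genObj : C := ChosenPullbacksAlong.pullbackObj S.Id π

/-- The boundary evaluation `Id_U(T) ⟶ T ×_U T`. -/
noncomputable def genEv : S.genObj ⟶ pullback π π := ChosenPullbacksAlong.fst S.Id π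

noncomputable def genVar : S.genObj ⟶ T := ChosenPullbacksAlong.snd S.Id π

/-- The reflexivity map `T ⟶ Id_U(T)`. -/
noncomputable def genRefl : T ⟶ S.genObj :=
  ChosenPullbacksAlong.lift (pullback.diagonal π) S.reflName S.comm.symm

@[simp]
lemma genRefl_ev : S.genRefl ≫ S.genEv = pullback.diagonal π :=
  ChosenPullbacksAlong.lift_fst _ _ S.comm.symm

@[simp]
lemma genRefl_var : S.genRefl ≫ S.genVar = S.reflName :=
  ChosenPullbacksAlong.lift_snd _ _ S.comm.symm

lemma isPullback_gen : IsPullback S.genEv S.genVar S.Id π :=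
  ChosenPullbacksAlong.isPullback S.Id π

variable {E B : C} {p : E ⟶ B} (F : FibStr π p)

/-- The name of the identity type of a fibration `p : E ⟶ B` with a given fibrancy structure. -/
noncomputable def nameOf : pullback p p ⟶ U :=
  pullback.lift (pullback.fst p p ≫ F.point) (pullback.snd p p ≫ F.point) (by
    rw [Category.assoc, Category.assoc, F.isPullback.w, pullback.condition_assoc]) ≫ S.Id

/-- `Id_B(E)`. -/
noncomputable def obj : C := ChosenPullbacksAlong.pullbackObj (S.nameOf F) π

/-- The boundary evaluation `Id_B(E) ⟶ E ×_B E`. -/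
noncomputable def ev : S.obj F ⟶ pullback p p := ChosenPullbacksAlong.fst (S.nameOf F) π

noncomputable def var : S.obj F ⟶ T := ChosenPullbacksAlong.snd (S.nameOf F) π

lemma diagonal_nameOf : pullback.diagonal p ≫ S.nameOf F = (F.point ≫ S.reflName) ≫ π := by
  rw [Category.assoc, S.comm, nameOf, ← Category.assoc, ← Category.assoc]
  congr 1
  apply pullback.hom_ext
  · rw [Category.assoc, pullback.lift_fst, pullback.diagonal_fst_assoc, Category.assoc,
      pullback.diagonal_fst, Category.comp_id]
  · rw [Category.assoc, pullback.lift_snd, pullback.diagonal_snd_assoc, Category.assoc,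
      pullback.diagonal_snd, Category.comp_id]

/-- The reflexivity map `E ⟶ Id_B(E)`. -/
noncomputable def refl : E ⟶ S.obj F :=
  ChosenPullbacksAlong.lift (pullback.diagonal p) (F.point ≫ S.reflName) (S.diagonal_nameOf F)

@[simp]
lemma refl_ev : S.refl F ≫ S.ev F = pullback.diagonal p :=
  ChosenPullbacksAlong.lift_fst _ _ (S.diagonal_nameOf F)

@[simp]
lemma refl_var : S.refl F ≫ S.var F = F.point ≫ S.reflName :=
  ChosenPullbacksAlong.lift_snd _ _ (S.diagonal_nameOf F)

end PreIdStr

/-- An `Id`-type structure: a pre-`Id`-type structure together with a `J`-elimination structure,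
that is, a lifting structure over `U` of `refl : T ⟶ Id_U(T)` against `U × π`. -/
structure IdStr [HasFiniteLimits C] {T U : C} (π : T ⟶ U) [ChosenPullbacksAlong π]
    extends PreIdStr π where
  J : LiftStr toPreIdStr.genRefl (toPreIdStr.genEv ≫ pullback.fst π π ≫ π) π

/-- `Unit`-, `Σ`-, `Π`- and `Id`-type structures on a universal map. -/
structure TypeFormers [HasFiniteLimits C] (w : UniversalMap C) where
  unit : FibStr w.π (𝟙 (⊤_ C))
  sigma : FibStr w.π (w.str.genComp w.π)
  pi : FibStr w.π (w.str.polyMap w.π)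
  id : IdStr w.π

end UniverseCategories

section Gluing

variable {C₀ : Type u₀} [Category.{v₀} C₀] [HasFiniteLimits C₀]
  {C₁ : Type u₁} [Category.{v₁} C₁] [HasFiniteLimits C₁]

/-- The image of a base change under a finite-limit preserving functor. -/
def BaseChange.map (M : C₀ ⥤ C₁) [PreservesFiniteLimits M] {Y E B : C₀} {s : Y ⟶ E}
    {e : E ⟶ B} (c : BaseChange s e) : BaseChange (M.map s) (M.map e) where
  B' := M.obj c.B'
  E' := M.obj c.E'
  Y' := M.obj c.Y'
  f := M.map c.f
  e' := M.map c.e'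
  s' := M.map c.s'
  g := M.map c.g
  h := M.map c.h
  isPullback_e := c.isPullback_e.map M
  isPullback_s := c.isPullback_s.map M

/-- A family of maps, indexed by the maps `s : Y ⟶ E` of the `π₀`-fibrant slices of `C₀`, from the
lifting structures of `s` against `π₀` to those of `M s` against `π₁`, compatible with base
change. -/
structure LiftTransfer (M : C₀ ⥤ C₁) [PreservesFiniteLimits M] {T₀ U₀ : C₀} (π₀ : T₀ ⟶ U₀)
    {T₁ U₁ : C₁} (π₁ : T₁ ⟶ U₁) where
  map {Y E B : C₀} (s : Y ⟶ E) (e : E ⟶ B) (hY : IsFib π₀ (s ≫ e)) (hE : IsFib π₀ e)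
    (L : LiftStr s e π₀) : LiftStr (M.map s) (M.map e) π₁
  restrict_map {Y E B : C₀} (s : Y ⟶ E) (e : E ⟶ B) (hY : IsFib π₀ (s ≫ e)) (hE : IsFib π₀ e)
    (L : LiftStr s e π₀) (c : BaseChange s e) (hY' : IsFib π₀ (c.s' ≫ c.e'))
    (hE' : IsFib π₀ c.e') :
    (map s e hY hE L).restrict (c.map M) = map c.s' c.e' hY' hE' (L.restrict c)

/-- The Artin–Wraith gluing category: objects are maps `X : X₁ ⟶ M X₀` of `C₁`.  For
`X : Gl M`, the components `X₁` and `X₀` are `X.left` and `X.right`. -/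
abbrev Gl (M : C₀ ⥤ C₁) := Comma (𝟭 C₁) M

variable {M : C₀ ⥤ C₁}

/-- An object of the gluing category as a map of `C₁`, its absolute matching map. -/
abbrev absMatch (X : Gl M) : X.left ⟶ M.obj X.right := X.hom

lemma absMatch_w {X Y : Gl M} (f : Y ⟶ X) :
    f.left ≫ absMatch X = absMatch Y ≫ M.map f.right := CommaMorphism.w f

/-- The relative matching object of a map `f : Y ⟶ X`. -/
noncomputable def relObj {X Y : Gl M} (f : Y ⟶ X) : C₁ :=
  pullback (absMatch X) (M.map f.right)

noncomputable def relFst {X Y : Gl M} (f : Y ⟶ X) : relObj f ⟶ X.left := pullback.fst _ _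

noncomputable def relSnd {X Y : Gl M} (f : Y ⟶ X) : relObj f ⟶ M.obj Y.right := pullback.snd _ _

lemma isPullback_rel {X Y : Gl M} (f : Y ⟶ X) :
    IsPullback (relFst f) (relSnd f) (absMatch X) (M.map f.right) :=
  IsPullback.of_hasPullback _ _

/-- The relative matching map `Y₁ ⟶ relObj f` of a map `f : Y ⟶ X`. -/
noncomputable def relMap {X Y : Gl M} (f : Y ⟶ X) : Y.left ⟶ relObj f :=
  (isPullback_rel f).lift f.left (absMatch Y) (absMatch_w f)

/-- The relative matching object is functorial in maps over `X`. -/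
noncomputable def relOver {X Y Y' : Gl M} (k : Y ⟶ Y') (f : Y ⟶ X) (f' : Y' ⟶ X)
    (h : k ≫ f' = f) : relObj f ⟶ relObj f' :=
  (isPullback_rel f').lift (relFst f) (relSnd f ≫ M.map k.right) (by
    rw [(isPullback_rel f).w, Category.assoc, ← M.map_comp, ← h, Comma.comp_right])

/-- The projection from the relative matching object of `f : Z ⟶ Y` to that of
`Z ⟶ Y ⟶ X`. -/
noncomputable def relDown {X Y Z : Gl M} (f : Z ⟶ Y) (q : Y ⟶ X) : relObj f ⟶ relObj (f ≫ q) :=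
  (isPullback_rel (f ≫ q)).lift (relFst f ≫ q.left) (relSnd f) (by
    rw [Category.assoc, absMatch_w q, ← Category.assoc, (isPullback_rel f).w, Comma.comp_right,
      M.map_comp, Category.assoc])

section

variable {X Y Y' Z : Gl M} (f : Y ⟶ X)

@[simp]
lemma relMap_fst : relMap f ≫ relFst f = f.left := IsPullback.lift_fst _ _ _ _

@[simp]
lemma relMap_snd : relMap f ≫ relSnd f = absMatch Y := IsPullback.lift_snd _ _ _ _

variable (k : Y ⟶ Y') (f' : Y' ⟶ X) (h : k ≫ f' = f)

@[simp]
lemma relOver_fst : relOver k f f' h ≫ relFst f' = relFst f := IsPullback.lift_fst _ _ _ _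

@[simp]
lemma relOver_snd : relOver k f f' h ≫ relSnd f' = relSnd f ≫ M.map k.right :=
  IsPullback.lift_snd _ _ _ _

variable (g : Z ⟶ Y)

@[simp]
lemma relDown_fst : relDown g f ≫ relFst (g ≫ f) = relFst g ≫ f.left :=
  IsPullback.lift_fst _ _ _ _

@[simp]
lemma relDown_snd : relDown g f ≫ relSnd (g ≫ f) = relSnd g := IsPullback.lift_snd _ _ _ _

lemma rel_hom_ext {W : C₁} {a b : W ⟶ relObj f} (h₁ : a ≫ relFst f = b ≫ relFst f)
    (h₂ : a ≫ relSnd f = b ≫ relSnd f) : a = b := (isPullback_rel f).hom_ext h₁ h₂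

end

/-- Reedy fibrations of the gluing category. -/
def IsReedyFib {T₀ U₀ : C₀} (π₀ : T₀ ⟶ U₀) {T₁ U₁ : C₁} (π₁ : T₁ ⟶ U₁) {X Y : Gl M}
    (f : Y ⟶ X) : Prop :=
  IsFib π₀ f.right ∧ IsFib π₁ (relMap f)

/-! ### The universal Reedy fibration -/

section Tau

variable {T₀ U₀ : C₀} {π₀ : T₀ ⟶ U₀} (e : ExpStr (M.map π₀)) {T₁ U₁ : C₁} (π₁ : T₁ ⟶ U₁)

/-- The base `V` of `τ`, with `V₀ = U₀` and `V₁` the value at `U₁` of the polynomial functor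
associated with `M π₀`. -/
noncomputable abbrev tauBase : Gl M where
  left := (e.polyObj U₁).left
  right := U₀
  hom := (e.polyObj U₁).hom

/-- The domain of `τ`. -/
noncomputable abbrev tauTot : Gl M where
  left := pullback (e.polyEv U₁) π₁
  right := T₀
  hom := pullback.fst (e.polyEv U₁) π₁ ≫ (e.polyTot U₁).hom

/-- The map `τ`, with 0-component `π₀` and 1-component the generic composite of `π₁` and
`M π₀`. -/
noncomputable abbrev tau : tauTot e π₁ ⟶ tauBase (U₁ := U₁) e where
  left := e.genComp π₁
  right := π₀
  w := by
    have := (e.isPullback_poly U₁).w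
    simp [ExpStr.genComp, this]

/-- The tautological fibrancy structure of the relative matching map of `τ`: this map is the
pullback of `π₁` along the evaluation. -/
noncomputable def tauFib : FibStr π₁ (relMap (tau e π₁)) where
  name := (e.isPullback_poly U₁).lift (relFst (tau e π₁)) (relSnd (tau e π₁))
    (isPullback_rel (tau e π₁)).w ≫ e.polyEv U₁
  point := pullback.snd (e.polyEv U₁) π₁
  isPullback := by
    let j : relObj (tau e π₁) ≅ (e.polyTot U₁).left :=
      IsPullback.isoIsPullback _ _ (isPullback_rel (tau e π₁)) (e.isPullback_poly U₁)
    have hj : j.hom = (e.isPullback_poly U₁).lift (relFst (tau e π₁)) (relSnd (tau e π₁))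
        (isPullback_rel (tau e π₁)).w := by
      apply (e.isPullback_poly U₁).hom_ext <;> simp [j]
    rw [← hj]
    refine IsPullback.of_iso (IsPullback.of_hasPullback (e.polyEv U₁) π₁).flip (Iso.refl _)
      (Iso.refl _) j.symm (Iso.refl _) (by simp) ?_ (by simp) (by simp)
    rw [← cancel_mono j.hom]
    apply (e.isPullback_poly U₁).hom_ext
    · have h₁ : j.hom ≫ e.polyProj U₁ = relFst (tau e π₁) := by
        rw [hj]; exact IsPullback.lift_fst _ _ _ _
      simp only [Iso.symm_hom, Iso.refl_hom, Category.assoc, Iso.inv_hom_id_assoc, Category.id_comp]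
      rw [h₁, relMap_fst]
      rfl
    · have h₁ : j.hom ≫ (e.polyTot U₁).hom = relSnd (tau e π₁) := by
        rw [hj]; exact IsPullback.lift_snd _ _ _ _
      simp only [Iso.symm_hom, Iso.refl_hom, Category.assoc, Iso.inv_hom_id_assoc, Category.id_comp]
      rw [h₁, relMap_snd]

end Tau

/-! ### Identity types preserved by the projection to `C₀` -/

section Preserved

variable [PreservesFiniteLimits M]

/-- The comparison from the 0-component of `Y ×_X Y` to `Y₀ ×_{X₀} Y₀`. -/
noncomputable def prodRight {X Y : Gl M} (f : Y ⟶ X) :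
    (pullback f f).right ⟶ pullback f.right f.right :=
  pullback.lift (pullback.fst f f).right (pullback.snd f f).right (by
    rw [← Comma.comp_right, ← Comma.comp_right, pullback.condition])

lemma right_isPullback {P X Y Z : Gl M} {a : P ⟶ X} {b : P ⟶ Y} {f : X ⟶ Z} {g : Y ⟶ Z}
    (h : IsPullback a b f g) : IsPullback a.right b.right f.right g.right :=
  have : PreservesLimit (cospan f g) (Comma.snd (𝟭 C₁) M) :=
    preservesLimit_of_preserves_limit_cone
      (Comma.coneOfPreservesIsLimit (cospan f g)
        (limit.isLimit (cospan f g ⋙ Comma.fst (𝟭 C₁) M))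
        (limit.isLimit (cospan f g ⋙ Comma.snd (𝟭 C₁) M)))
      (IsLimit.ofIsoLimit (limit.isLimit (cospan f g ⋙ Comma.snd (𝟭 C₁) M))
        (Cone.ext (Iso.refl _) (by intro; simp [Comma.coneOfPreserves])))
  h.map (Comma.snd (𝟭 C₁) M)

@[simp]
lemma prodRight_fst {X Y : Gl M} (f : Y ⟶ X) :
    prodRight f ≫ pullback.fst f.right f.right = (pullback.fst f f).right :=
  pullback.lift_fst _ _ _

@[simp]
lemma prodRight_snd {X Y : Gl M} (f : Y ⟶ X) :
    prodRight f ≫ pullback.snd f.right f.right = (pullback.snd f f).right :=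
  pullback.lift_snd _ _ _

lemma diagonal_right {X Y : Gl M} (f : Y ⟶ X) :
    (pullback.diagonal f).right ≫ prodRight f = pullback.diagonal f.right := by
  apply pullback.hom_ext
  · rw [Category.assoc, prodRight_fst, ← Comma.comp_right, pullback.diagonal_fst,
      pullback.diagonal_fst, Comma.id_right]
  · rw [Category.assoc, prodRight_snd, ← Comma.comp_right, pullback.diagonal_snd,
      pullback.diagonal_snd, Comma.id_right]

instance {X Y : Gl M} (f : Y ⟶ X) : IsIso (prodRight f) := by
  have h := right_isPullback (IsPullback.of_hasPullback f f)
  have e : prodRight f =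
      (IsPullback.isoIsPullback _ _ h (IsPullback.of_hasPullback f.right f.right)).hom := by
    apply pullback.hom_ext
    · rw [prodRight_fst, IsPullback.isoIsPullback_hom_fst]
    · rw [prodRight_snd, IsPullback.isoIsPullback_hom_snd]
  rw [e]
  infer_instance

variable {V T : Gl M} {t : T ⟶ V} [ChosenPullbacksAlong t] [ChosenPullbacksAlong t.right]
  (S : PreIdStr t) (S₀ : PreIdStr t.right)

/-- `S` and `S₀` have the same formation and reflexivity maps, up to the comparison
isomorphism `prodRight`. -/
structure PreIdStr.PreservedBySnd : Prop where
  id_right : S.Id.right = prodRight t ≫ S₀.Id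
  reflName_right : S.reflName.right = S₀.reflName

variable {S S₀} (h : S.PreservedBySnd S₀)

lemma PreIdStr.PreservedBySnd.isPullback (h : S.PreservedBySnd S₀) :
    IsPullback (S.genEv.right ≫ prodRight t) S.genVar.right S₀.Id t.right := by
  have := right_isPullback S.isPullback_gen
  rw [h.id_right] at this
  exact IsPullback.of_iso this (Iso.refl _) (asIso (prodRight t)) (Iso.refl _) (Iso.refl _)
    (by simp) (by simp) (by simp) (by simp)

/-- The comparison isomorphism from the 0-component of the generic identity type. -/
noncomputable def PreIdStr.PreservedBySnd.iso : S.genObj.right ≅ S₀.genObj :=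
  IsPullback.isoIsPullback _ _ h.isPullback S₀.isPullback_gen

@[simp]
lemma PreIdStr.PreservedBySnd.iso_hom_ev :
    h.iso.hom ≫ S₀.genEv = S.genEv.right ≫ prodRight t := by
  simp [PreIdStr.PreservedBySnd.iso]

@[simp]
lemma PreIdStr.PreservedBySnd.iso_hom_var : h.iso.hom ≫ S₀.genVar = S.genVar.right := by
  simp [PreIdStr.PreservedBySnd.iso]

lemma PreIdStr.PreservedBySnd.refl_iso : S.genRefl.right ≫ h.iso.hom = S₀.genRefl := by
  apply S₀.isPullback_gen.hom_ext
  · rw [Category.assoc, h.iso_hom_ev, PreIdStr.genRefl_ev, ← Category.assoc, ← Comma.comp_right,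
      PreIdStr.genRefl_ev, diagonal_right]
  · rw [Category.assoc, h.iso_hom_var, PreIdStr.genRefl_var, ← Comma.comp_right,
      PreIdStr.genRefl_var, h.reflName_right]

/-- The 0-component of a base change of the generic reflexivity map. -/
noncomputable def PreIdStr.PreservedBySnd.baseChange
    (c : BaseChange S.genRefl (S.genEv ≫ pullback.fst t t ≫ t)) :
    BaseChange S₀.genRefl (S₀.genEv ≫ pullback.fst t.right t.right ≫ t.right) where
  B' := c.B'.right
  E' := c.E'.right
  Y' := c.Y'.right
  f := c.f.right
  e' := c.e'.right
  s' := c.s'.right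
  g := c.g.right ≫ h.iso.hom
  h := c.h.right
  isPullback_e := by
    refine IsPullback.of_iso (right_isPullback c.isPullback_e) (Iso.refl _) h.iso (Iso.refl _)
      (Iso.refl _) (by simp) (by simp) ?_ (by simp)
    rw [← Category.assoc h.iso.hom, h.iso_hom_ev, Category.assoc, ← Category.assoc (prodRight t),
      prodRight_fst]
    simp
  isPullback_s := by
    refine IsPullback.of_iso (right_isPullback c.isPullback_s) (Iso.refl _) (Iso.refl _)
      (Iso.refl _) h.iso (by simp) (by simp) ?_ (by simp)
    simp [h.refl_iso]

/-- The `Id`-type structure `S` on a map `t` of the gluing category is sent to the `Id`-type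
structure `S₀` on its 0-component by the projection to `C₀`: the formation map, the reflexivity
map and the `J`-elimination structure are all preserved. -/
structure IdStr.PreservedBySnd (S : IdStr t) (S₀ : IdStr t.right) : Prop where
  pre : S.toPreIdStr.PreservedBySnd S₀.toPreIdStr
  J_right (c : BaseChange S.genRefl (S.genEv ≫ pullback.fst t t ≫ t)) (a : c.Y' ⟶ T)
    (b : c.E' ⟶ V) (w : a ≫ t = c.s' ≫ b) :
    (S.J.fill c a b w).right =
      S₀.J.fill (pre.baseChange c) a.right b.right (congrArg CommaMorphism.right w)

end Preserved

/-! ### Factorizations of the diagonal of a Reedy fibration -/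

section Factorization

variable [PreservesFiniteLimits M] {E B I : Gl M} (p : E ⟶ B) (r : E ⟶ I) (ev : I ⟶ pullback p p)

/-- The structure map `I ⟶ B` of the domain of `ev : I ⟶ E ×_B E`, regarded as an object
over `B`. -/
noncomputable abbrev toBase : I ⟶ B := ev ≫ pullback.fst p p ≫ p

/-- The map `I ⟶ E ×_B E ⟶ E` (first projection), on relative matching objects over `B`. -/
noncomputable def endLeft : relObj (toBase p ev) ⟶ relObj p :=
  relOver (ev ≫ pullback.fst p p) (toBase p ev) p (Category.assoc _ _ _)

/-- The map `I ⟶ E ×_B E ⟶ E` (second projection), on relative matching objects over `B`. -/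
noncomputable def endRight : relObj (toBase p ev) ⟶ relObj p :=
  relOver (ev ≫ pullback.snd p p) (toBase p ev) p (by
    rw [Category.assoc, toBase, pullback.condition])

/-- The projection from the relative matching object of `ev` to that of `I ⟶ B`. -/
noncomputable def downBase : relObj ev ⟶ relObj (toBase p ev) :=
  relDown ev (pullback.fst p p ≫ p)

@[simp]
lemma endLeft_fst : endLeft p ev ≫ relFst p = relFst (toBase p ev) := relOver_fst ..

@[simp]
lemma endLeft_snd : endLeft p ev ≫ relSnd p =
    relSnd (toBase p ev) ≫ M.map (ev ≫ pullback.fst p p).right := relOver_snd ..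

@[simp]
lemma endRight_fst : endRight p ev ≫ relFst p = relFst (toBase p ev) := relOver_fst ..

@[simp]
lemma endRight_snd : endRight p ev ≫ relSnd p =
    relSnd (toBase p ev) ≫ M.map (ev ≫ pullback.snd p p).right := relOver_snd ..

@[simp]
lemma downBase_fst : downBase p ev ≫ relFst (toBase p ev) =
    relFst ev ≫ (pullback.fst p p ≫ p).left := relDown_fst ..

@[simp]
lemma downBase_snd : downBase p ev ≫ relSnd (toBase p ev) = relSnd ev := relDown_snd ..

/-- The map from the relative matching object of `ev` to the pullback of `E₁ ⟶ relObj p` along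
`endLeft`, given by the first projection `E ×_B E ⟶ E`. -/
noncomputable def matchLeft : relObj ev ⟶ pullback (endLeft p ev) (relMap p) :=
  pullback.lift (downBase p ev) (relFst ev ≫ (pullback.fst p p).left) (by
    apply rel_hom_ext
    · rw [Category.assoc, Category.assoc, endLeft_fst, downBase_fst, Category.assoc, relMap_fst,
        Comma.comp_left]
    · rw [Category.assoc, Category.assoc, endLeft_snd, ← Category.assoc, downBase_snd,
        Category.assoc, relMap_snd, absMatch_w, ← Category.assoc, (isPullback_rel ev).w,
        Category.assoc, ← M.map_comp, Comma.comp_right])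

/-- The map from the relative matching object of `ev` to the pullback of `E₁ ⟶ relObj p` along
`endRight`, given by the second projection `E ×_B E ⟶ E`. -/
noncomputable def matchRight : relObj ev ⟶ pullback (endRight p ev) (relMap p) :=
  pullback.lift (downBase p ev) (relFst ev ≫ (pullback.snd p p).left) (by
    apply rel_hom_ext
    · rw [Category.assoc, Category.assoc, endRight_fst, downBase_fst, Category.assoc, relMap_fst,
        pullback.condition, Comma.comp_left]
    · rw [Category.assoc, Category.assoc, endRight_snd, ← Category.assoc, downBase_snd,
        Category.assoc, relMap_snd, absMatch_w, ← Category.assoc, (isPullback_rel ev).w,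
        Category.assoc, ← M.map_comp, Comma.comp_right])

variable {p r ev} (fac : r ≫ ev = pullback.diagonal p)

/-- The map of relative matching objects over `B` induced by `r : E ⟶ I`. -/
noncomputable def relRefl (fac : r ≫ ev = pullback.diagonal p) :
    relObj p ⟶ relObj (toBase p ev) :=
  relOver r p (toBase p ev) (by
    rw [toBase, ← Category.assoc, fac, ← Category.assoc, pullback.diagonal_fst, Category.id_comp])

lemma relRefl_endLeft : relRefl fac ≫ endLeft p ev = 𝟙 (relObj p) := by
  apply rel_hom_ext
  · rw [Category.assoc, endLeft_fst, relRefl, relOver_fst, Category.id_comp]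
  · rw [Category.assoc, endLeft_snd, relRefl, ← Category.assoc, relOver_snd, Category.assoc,
      ← M.map_comp, ← Comma.comp_right, ← Category.assoc, fac, pullback.diagonal_fst,
      Comma.id_right, M.map_id, Category.comp_id, Category.id_comp]

lemma relRefl_endRight : relRefl fac ≫ endRight p ev = 𝟙 (relObj p) := by
  apply rel_hom_ext
  · rw [Category.assoc, endRight_fst, relRefl, relOver_fst, Category.id_comp]
  · rw [Category.assoc, endRight_snd, relRefl, ← Category.assoc, relOver_snd, Category.assoc,
      ← M.map_comp, ← Comma.comp_right, ← Category.assoc, fac, pullback.diagonal_snd,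
      Comma.id_right, M.map_id, Category.comp_id, Category.id_comp]

/-- The map from `E₁` to the pullback of `E₁ ⟶ relObj p` along `endLeft`, over `relRefl`. -/
noncomputable def reflLeft : E.left ⟶ pullback (endLeft p ev) (relMap p) :=
  pullback.lift (relMap p ≫ relRefl fac) (𝟙 E.left) (by
    rw [Category.assoc, relRefl_endLeft, Category.comp_id, Category.id_comp])

/-- The map from `E₁` to the pullback of `E₁ ⟶ relObj p` along `endRight`, over `relRefl`. -/
noncomputable def reflRight : E.left ⟶ pullback (endRight p ev) (relMap p) :=
  pullback.lift (relMap p ≫ relRefl fac) (𝟙 E.left) (by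
    rw [Category.assoc, relRefl_endRight, Category.comp_id, Category.id_comp])

variable {T₀ U₀ : C₀} {π₀ : T₀ ⟶ U₀} [ChosenPullbacksAlong π₀]
  {T₁ U₁ : C₁} {π₁ : T₁ ⟶ U₁} [ChosenPullbacksAlong π₁]

/-- The fibrancy structure of the pullback of `relMap p` along `endRight`. -/
noncomputable def fibRight (F₁ : FibStr π₁ (relMap p)) (ev : I ⟶ pullback p p) :
    FibStr π₁ (pullback.fst (endRight p ev) (relMap p)) :=
  F₁.pull (IsPullback.of_hasPullback (endRight p ev) (relMap p)).flip

/-- `E --r--> I --ev--> E ×_B E` is a factorization of the diagonal of the Reedy fibration `p`,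
obtained from the identity types of `π₀` and of `π₁` as follows.

The 0-component is the identity type of `p₀`.  Write `R` for the relative matching object of
`I ⟶ B`, and `P` and `Q` for the two pullbacks of `E₁ ⟶ relObj p` along `R ⇉ relObj p`.  There is
a transport map `P ⟶ Q` over `R`, whose restriction along `relRefl : relObj p ⟶ R` is the identity
of `E₁`; and `I₁` is the pullback of the identity type of `Q` over `R` along
`(transport × 1) : relObj ev ⟶ Q ×_R Q`.  Pulling `relMap ev` back along `relRefl` gives the
identity type of `E₁` over `relObj p`, and `r₁` is the reflexivity map of the latter followed by
the inclusion. -/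
structure IdFactorization (S₀ : PreIdStr π₀) (S₁ : PreIdStr π₁) (p : E ⟶ B)
    (F₀ : FibStr π₀ p.right) (F₁ : FibStr π₁ (relMap p)) (r : E ⟶ I) (ev : I ⟶ pullback p p) where
  fac : r ≫ ev = pullback.diagonal p
  reedy : IsReedyFib π₀ π₁ ev
  iso₀ : I.right ≅ S₀.obj F₀
  iso₀_ev : iso₀.hom ≫ S₀.ev F₀ = ev.right ≫ prodRight p
  refl_iso₀ : r.right ≫ iso₀.hom = S₀.refl F₀
  transport : pullback (endLeft p ev) (relMap p) ⟶ pullback (endRight p ev) (relMap p)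
  transport_over : transport ≫ pullback.fst (endRight p ev) (relMap p) =
    pullback.fst (endLeft p ev) (relMap p)
  transport_refl : reflLeft fac ≫ transport = reflRight fac
  twist : relObj ev ⟶
    pullback (pullback.fst (endRight p ev) (relMap p)) (pullback.fst (endRight p ev) (relMap p))
  twist_fst : twist ≫ pullback.fst _ _ = matchLeft p ev ≫ transport
  twist_snd : twist ≫ pullback.snd _ _ = matchRight p ev
  toId : I.left ⟶ S₁.obj (fibRight F₁ ev)
  isPullback_toId : IsPullback toId (relMap ev) (S₁.ev (fibRight F₁ ev)) twist
  inclBase : pullback (relMap p) (relMap p) ⟶ relObj ev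
  inclBase_fst : inclBase ≫ relFst ev ≫ (pullback.fst p p).left =
    pullback.fst (relMap p) (relMap p)
  inclBase_snd : inclBase ≫ relFst ev ≫ (pullback.snd p p).left =
    pullback.snd (relMap p) (relMap p)
  isPullback_inclBase : IsPullback inclBase (pullback.fst (relMap p) (relMap p) ≫ relMap p)
    (downBase p ev) (relRefl fac)
  incl : S₁.obj F₁ ⟶ I.left
  isPullback_incl : IsPullback incl (S₁.ev F₁) (relMap ev) inclBase
  incl_toId : incl ≫ toId ≫ S₁.var (fibRight F₁ ev) = S₁.var F₁
  refl_left : S₁.refl F₁ ≫ incl = r.left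

end Factorization

/-- The assertion about identity types in the gluing category, for the universal maps `w₀` of `C₀`
and `w₁` of `C₁` with `Id`-type structures `S₀` and `S₁`. -/
structure GluedIdTypes (M : C₀ ⥤ C₁) [PreservesFiniteLimits M] (w₀ : UniversalMap C₀)
    (w₁ : UniversalMap C₁) (S₀ : IdStr w₀.π) (S₁ : IdStr w₁.π) : Prop where
  /-- The map `τ` can be formed. -/
  expo : Nonempty (ExpStr (M.map w₀.π))
  /-- The map `τ` has an `Id`-type structure preserved by the projection to `C₀`, which is the
  factorization of the diagonal of the Reedy fibration `τ`. -/
  universal (e : ExpStr (M.map w₀.π)) [ChosenPullbacksAlong (tau e w₁.π)] :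
    ∃ S : IdStr (tau e w₁.π), IdStr.PreservedBySnd (t := tau e w₁.π) S S₀ ∧
      Nonempty (IdFactorization S₀.toPreIdStr S₁.toPreIdStr (tau e w₁.π) (FibStr.self w₀.π)
        (tauFib e w₁.π) S.genRefl S.genEv)
  /-- The diagonal of each Reedy fibration `p : E ⟶ B` is factored in this way, and the left factor
  has a lifting structure over `B` against `B × τ`. -/
  factorization (e : ExpStr (M.map w₀.π)) {E B : Gl M} (p : E ⟶ B) (F₀ : FibStr w₀.π p.right)
    (F₁ : FibStr w₁.π (relMap p)) :
    ∃ (I : Gl M) (r : E ⟶ I) (ev : I ⟶ pullback p p),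
      Nonempty (IdFactorization S₀.toPreIdStr S₁.toPreIdStr p F₀ F₁ r ev) ∧
      Nonempty (LiftStr r (toBase p ev) (tau e w₁.π))

end Gluing

end GlueId

/-! The identity type of a Reedy fibration `p` is built in two layers. The 0-component is the
identity type of `p₀`. Over it, the two endpoints of a path in the 1-component lie in two different
pullbacks `P` and `Q` of `E₁ ⟶ relObj p` over `R`, the relative matching object of `I ⟶ B`, and
cannot be compared directly. The comparison comes from the transfer hypothesis: reflexivity of `p₀`
lifts against `π₀`, so its image under `M` lifts against `π₁`, and base change along `B₁ ⟶ M B₀`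
gives a lifting structure for `ρ : relObj p ⟶ R`. Lifting `P` against `Q ⟶ R` along a pullback of
`ρ` yields a transport map that is strictly the identity over `ρ` (`exists_transport`). A path in
the 1-component is then a path in `Q` from the transported first endpoint to the second.

For elimination, `refl₁` factors as the reflexivity map of `E₁` over `relObj p` followed by an
inclusion into `I₁`. The first factor lifts by the `J`-structure of `π₁`. The second is a base
change of `ρ` along the composite fibration `I₁ ⟶ R`, and lifts by the Frobenius property, which
comes from Π-types (`LiftStr.frobenius`, `liftIdIncl`). A lifting problem against `τ` is solved
first in the 0-component and then in the 1-component against the relative matching map of `τ`, which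
is a `π₁`-fibration (`gluedLift`).

An `Id`-type structure on `τ` needs all this to be classified by a map `n : E ×_B E ⟶ tauBase`. The
relative matching object over the 0-level identity type is a pullback of `M π₀`, so the name of the
1-level identity type transposes to a map into the polynomial functor of `M π₀` at `U₁`. Every
pullback of `τ` along `n`, canonical or chosen, then carries the required factorization
(`exists_idName`), which gives both halves of the theorem. The map `M π₀` is exponentiable because
it is a `π₁`-fibration and exponentiable maps are stable under pullback (`ExpStr.ofIsPullback`). -/

namespace GlueId

universe v u v₀ u₀ v₁ u₁

/-! ### Universal property of polynomial functors and generic composites. -/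

section Polynomial

variable {C : Type u} [Category.{v} C] [HasFiniteLimits C]

namespace ExpStr

variable {E B : C} {f : E ⟶ B} (e : ExpStr f)

/-- The map out of `D` classified by a map `a : A ⟶ f_*(E × X)`, for a commutative square with
sides `d : D ⟶ A` and `t : D ⟶ E`. -/
noncomputable def eval {X A D : C} (a : A ⟶ (e.polyObj X).left) (d : D ⟶ A) (t : D ⟶ E)
    (w : d ≫ a ≫ (e.polyObj X).hom = t ≫ f) : D ⟶ X :=
  (e.isPullback_poly X).lift (d ≫ a) t (by rw [Category.assoc, w]) ≫ e.polyEv X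

lemma comp_eval {X A D D' : C} (a : A ⟶ (e.polyObj X).left) (d : D ⟶ A) (t : D ⟶ E)
    (w : d ≫ a ≫ (e.polyObj X).hom = t ≫ f) (g : D' ⟶ D) :
    g ≫ e.eval a d t w = e.eval a (g ≫ d) (g ≫ t) (by simp [w]) := by
  rw [eval, eval, ← Category.assoc]
  congr 1
  apply (e.isPullback_poly X).hom_ext <;> simp

lemma eval_comp {X A A' D : C} (k : A' ⟶ A) (a : A ⟶ (e.polyObj X).left) (d : D ⟶ A')
    (t : D ⟶ E) (w : d ≫ (k ≫ a) ≫ (e.polyObj X).hom = t ≫ f) :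
    e.eval (k ≫ a) d t w = e.eval a (d ≫ k) t (by simpa using w) := by
  simp [eval]

lemma eval_congr {X A D : C} {a a' : A ⟶ (e.polyObj X).left} {d d' : D ⟶ A} {t t' : D ⟶ E}
    (ha : a = a') (hd : d = d') (ht : t = t') (w : d ≫ a ≫ (e.polyObj X).hom = t ≫ f) :
    e.eval a d t w = e.eval a' d' t' (by rw [← ha, ← hd, ← ht, w]) := by
  subst ha hd ht; rfl

@[simp]
lemma polyMap_hom {X Y : C} (k : X ⟶ Y) :
    e.polyMap k ≫ (e.polyObj Y).hom = (e.polyObj X).hom :=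
  let _ := e.chosen
  let _ := e.expo
  Over.w ((ExponentiableMorphism.pushforward f).map
    (Over.homMk (prod.map (𝟙 E) k) : Over.mk (prod.fst : E ⨯ X ⟶ E) ⟶
      Over.mk (prod.fst : E ⨯ Y ⟶ E)))

/-- Naturality of the two counits, of composition-pullback and of pullback-pushforward, lets `k`
pass through projection and evaluation. -/
lemma exists_polyTot_map {X Y : C} (k : X ⟶ Y) :
    ∃ m : (e.polyTot X).left ⟶ (e.polyTot Y).left, m ≫ e.polyProj Y = e.polyProj X ≫ e.polyMap k ∧
      m ≫ (e.polyTot Y).hom = (e.polyTot X).hom ∧ m ≫ e.polyEv Y = e.polyEv X ≫ k := by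
  let _ := e.chosen
  let _ := e.expo
  let κ : Over.mk (prod.fst : E ⨯ X ⟶ E) ⟶ Over.mk (prod.fst : E ⨯ Y ⟶ E) :=
    Over.homMk (prod.map (𝟙 E) k)
  let m := (ChosenPullbacksAlong.pullback f).map ((ExponentiableMorphism.pushforward f).map κ)
  refine ⟨m.left, congrArg CommaMorphism.left
    ((ChosenPullbacksAlong.mapPullbackAdj f).counit.naturality
      ((ExponentiableMorphism.pushforward f).map κ)), Over.w m, ?_⟩
  have h := congrArg CommaMorphism.left
    ((ExponentiableMorphism.pullbackPushforwardAdj f).counit.naturality κ)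
  have hκ : κ.left ≫ prod.snd = prod.snd ≫ k := prod.map_snd _ _
  exact (Category.assoc _ _ _).symm.trans <| (congrArg (· ≫ prod.snd) h).trans <|
    (Category.assoc _ _ _).trans <| (congrArg (CommaMorphism.left
      ((ExponentiableMorphism.pullbackPushforwardAdj f).counit.app _) ≫ ·) hκ).trans
      (Category.assoc _ _ _).symm

lemma eval_polyMap {X Y A D : C} (k : X ⟶ Y) (a : A ⟶ (e.polyObj X).left) (d : D ⟶ A)
    (t : D ⟶ E) (w : d ≫ (a ≫ e.polyMap k) ≫ (e.polyObj Y).hom = t ≫ f) :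
    e.eval (a ≫ e.polyMap k) d t w = e.eval a d t (by simpa using w) ≫ k := by
  obtain ⟨m, hm, hm', hev⟩ := e.exists_polyTot_map k
  rw [eval, eval, Category.assoc, ← hev, ← Category.assoc _ m]
  congr 1
  apply (e.isPullback_poly Y).hom_ext <;> simp [hm, hm']

/-- On the chosen pullback, evaluation is the `X`-component of the adjoint transpose. This is the
bridge from the adjunction to arbitrary pullback squares. -/
lemma eval_chosen {X A : C} {n : A ⟶ B} :
    letI := e.chosen
    letI := e.expo
    ∀ a : Over.mk n ⟶ e.polyObj X,
    e.eval a.left (ChosenPullbacksAlong.fst n f) (ChosenPullbacksAlong.snd n f)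
      (by rw [Over.w]; exact ChosenPullbacksAlong.condition) =
    (((ExponentiableMorphism.pullbackPushforwardAdj f).homEquiv _ _).symm a).left ≫ prod.snd := by
  let _ := e.chosen
  let _ := e.expo
  intro a
  have h : (e.isPullback_poly X).lift (ChosenPullbacksAlong.fst n f ≫ a.left)
      (ChosenPullbacksAlong.snd n f) (by
        rw [Category.assoc, Over.w]; exact ChosenPullbacksAlong.condition) =
      ((ChosenPullbacksAlong.pullback f).map a).left := by
    apply (e.isPullback_poly X).hom_ext
    · rw [IsPullback.lift_fst]
      exact (congrArg CommaMorphism.left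
        ((ChosenPullbacksAlong.mapPullbackAdj f).counit.naturality a)).symm
    · rw [IsPullback.lift_snd]
      exact (Over.w ((ChosenPullbacksAlong.pullback f).map a)).symm
  rw [eval, h]
  have hc : (((ExponentiableMorphism.pullbackPushforwardAdj f).homEquiv _ _).symm a).left =
      ((ChosenPullbacksAlong.pullback f).map a).left ≫
        ((ExponentiableMorphism.pullbackPushforwardAdj f).counit.app _).left :=
    congrArg CommaMorphism.left (Adjunction.homEquiv_counit _ _ _ a)
  exact (Category.assoc _ _ _).symm.trans (congrArg (· ≫ prod.snd) hc.symm)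

/-- Transposition is injective, and the `E`-component of a transpose is forced, so only the
`X`-component matters. That is an evaluation on the chosen pullback, which is obtained from the one
on `D` by the comparison map between the two pullbacks. -/
lemma poly_hom_ext {X A D : C} {a a' : A ⟶ (e.polyObj X).left} {d : D ⟶ A} {t : D ⟶ E}
    {n : A ⟶ B} (sq : IsPullback d t n f) (h : a ≫ (e.polyObj X).hom = n)
    (h' : a' ≫ (e.polyObj X).hom = n)
    (hev : e.eval a d t (by rw [h, sq.w]) = e.eval a' d t (by rw [h', sq.w])) : a = a' := by
  let _ := e.chosen
  let _ := e.expo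
  let α : Over.mk n ⟶ e.polyObj X := Over.homMk a h
  let α' : Over.mk n ⟶ e.polyObj X := Over.homMk a' h'
  suffices α = α' from congrArg CommaMorphism.left this
  apply ((ExponentiableMorphism.pullbackPushforwardAdj f).homEquiv _ _).symm.injective
  ext
  apply prod.hom_ext
  · exact (Over.w (((ExponentiableMorphism.pullbackPushforwardAdj f).homEquiv _ _).symm α)).trans
      (Over.w (((ExponentiableMorphism.pullbackPushforwardAdj f).homEquiv _ _).symm α')).symm
  · refine (e.eval_chosen α).symm.trans (Eq.trans ?_ (e.eval_chosen α'))
    have := congrArg (fun x => sq.lift (ChosenPullbacksAlong.fst n f)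
      (ChosenPullbacksAlong.snd n f) ChosenPullbacksAlong.condition ≫ x) hev
    simp only [comp_eval] at this
    convert this using 1 <;> apply eval_congr <;> simp [α, α']

lemma exists_polyLift {X A D : C} {d : D ⟶ A} {t : D ⟶ E}
    {n : A ⟶ B} (sq : IsPullback d t n f) (x : D ⟶ X) :
    ∃ (a : A ⟶ (e.polyObj X).left) (h : a ≫ (e.polyObj X).hom = n),
      e.eval a d t (by rw [h, sq.w]) = x := by
  let _ := e.chosen
  let _ := e.expo
  let j := sq.lift (ChosenPullbacksAlong.fst n f)
      (ChosenPullbacksAlong.snd n f) ChosenPullbacksAlong.condition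
  let β : (ChosenPullbacksAlong.pullback f).obj (Over.mk n) ⟶ Over.mk (prod.fst : E ⨯ X ⟶ E) :=
    Over.homMk (prod.lift (ChosenPullbacksAlong.snd n f) (j ≫ x)) (prod.lift_fst _ _)
  let α : Over.mk n ⟶ e.polyObj X :=
    (ExponentiableMorphism.pullbackPushforwardAdj f).homEquiv _ _ β
  refine ⟨α.left, Over.w α, ?_⟩
  have h := e.eval_chosen α
  have hβ : ((ExponentiableMorphism.pullbackPushforwardAdj f).homEquiv _ _).symm α = β :=
    Equiv.symm_apply_apply _ _
  rw [hβ] at h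
  have h2 : β.left ≫ prod.snd = j ≫ x := prod.lift_snd _ _
  rw [h2] at h
  let i : D ⟶ ChosenPullbacksAlong.pullbackObj n f := ChosenPullbacksAlong.lift d t sq.w
  have hij : i ≫ j = 𝟙 D := by
    apply sq.hom_ext <;> simp [i, j]
  have h3 := congrArg (fun y => i ≫ y) h
  simp only [comp_eval, reassoc_of% hij] at h3
  rw [← h3]
  apply eval_congr <;> simp [i]

/-- The map into `f_*(E × X)` classifying a map `x : D ⟶ X` out of a pullback `D` of `f`. -/
noncomputable def polyLift {X A D : C} {d : D ⟶ A} {t : D ⟶ E}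
    {n : A ⟶ B} (sq : IsPullback d t n f) (x : D ⟶ X) : A ⟶ (e.polyObj X).left :=
  (e.exists_polyLift sq x).choose

section

variable {X A D : C} {d : D ⟶ A} {t : D ⟶ E} {n : A ⟶ B} (sq : IsPullback d t n f) (x : D ⟶ X)

@[simp]
lemma polyLift_hom : e.polyLift sq x ≫ (e.polyObj X).hom = n :=
  (e.exists_polyLift sq x).choose_spec.choose

@[simp]
lemma eval_polyLift (w : d ≫ e.polyLift sq x ≫ (e.polyObj X).hom = t ≫ f) :
    e.eval (e.polyLift sq x) d t w = x :=
  (e.exists_polyLift sq x).choose_spec.choose_spec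

lemma polyLift_eval (a : A ⟶ (e.polyObj X).left) (h : a ≫ (e.polyObj X).hom = n) :
    e.polyLift sq (e.eval a d t (by rw [h, sq.w])) = a :=
  e.poly_hom_ext sq (by simp) h (by simp)

lemma comp_polyLift {A' D' : C} {d' : D' ⟶ A'} {t' : D' ⟶ E} {n' : A' ⟶ B}
    (sq' : IsPullback d' t' n' f) (k : A' ⟶ A) (l : D' ⟶ D) (hk : k ≫ n = n')
    (hl : l ≫ d = d' ≫ k) (ht : l ≫ t = t') :
    k ≫ e.polyLift sq x = e.polyLift sq' (l ≫ x) := by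
  apply e.poly_hom_ext sq' (by simp [hk]) (by simp)
  rw [eval_polyLift, eval_comp]
  conv_rhs => rw [← e.eval_polyLift sq x (by simp [sq.w]), comp_eval]
  apply eval_congr <;> simp [hl, ht]

lemma polyLift_polyMap {Y : C} (k : X ⟶ Y) :
    e.polyLift sq x ≫ e.polyMap k = e.polyLift sq (x ≫ k) := by
  apply e.poly_hom_ext sq (by simp) (by simp)
  rw [eval_polyLift, eval_polyMap, eval_polyLift]

/-- The map from `D` to the pullback of `f_*(E × X)` along `f`. -/
noncomputable def toPolyTot : D ⟶ (e.polyTot X).left :=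
  (e.isPullback_poly X).lift (d ≫ e.polyLift sq x) t (by simp [sq.w])

@[simp]
lemma toPolyTot_proj : e.toPolyTot sq x ≫ e.polyProj X = d ≫ e.polyLift sq x :=
  IsPullback.lift_fst _ _ _ _

@[simp]
lemma toPolyTot_hom : e.toPolyTot sq x ≫ (e.polyTot X).hom = t := IsPullback.lift_snd _ _ _ _

@[simp]
lemma toPolyTot_ev : e.toPolyTot sq x ≫ e.polyEv X = x :=
  e.eval_polyLift sq x (by simp [sq.w])

/-- Pasting with the defining square of `polyTot` gives the square `sq`, so the left square is a
pullback. -/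
lemma isPullback_toPolyTot :
    IsPullback (e.toPolyTot sq x) d (e.polyProj X) (e.polyLift sq x) :=
  IsPullback.of_right (h₁₂ := (e.polyTot X).hom) (h₂₂ := (e.polyObj X).hom) (v₁₃ := f)
    (by simpa using sq.flip) (by simp) (e.isPullback_poly X).flip

variable {Y Z : C} {q : Y ⟶ X} {y : Z ⟶ Y} {z : Z ⟶ D} (sq' : IsPullback y z q x)

/-- The map to the domain of a generic composite classifying a composite of pullbacks. -/
noncomputable def toGenComp : Z ⟶ pullback (e.polyEv X) q :=
  pullback.lift (z ≫ e.toPolyTot sq x) y (by rw [Category.assoc, toPolyTot_ev, sq'.w])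

@[simp]
lemma toGenComp_fst : e.toGenComp sq x sq' ≫ pullback.fst (e.polyEv X) q = z ≫ e.toPolyTot sq x :=
  pullback.lift_fst _ _ _

@[simp]
lemma toGenComp_snd : e.toGenComp sq x sq' ≫ pullback.snd (e.polyEv X) q = y :=
  pullback.lift_snd _ _ _

/-- The pullback of a generic composite along the map classifying `x : D ⟶ X`. -/
lemma isPullback_genComp :
    IsPullback (e.toGenComp sq x sq') (z ≫ d) (e.genComp q) (e.polyLift sq x) :=
  IsPullback.paste_vert (IsPullback.of_right (h₁₂ := pullback.snd _ _) (h₂₂ := e.polyEv X)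
    (v₁₃ := q) (by simpa using sq') (e.toGenComp_fst sq x sq')
    (IsPullback.of_hasPullback (e.polyEv X) q).flip) (e.isPullback_toPolyTot sq x)

/-- A pullback of a generic composite along the map classifying `x : D ⟶ X` is given by a pullback
along `x`. -/
lemma isPullback_of_genComp {W : C} {a : W ⟶ pullback (e.polyEv X) q} {b : W ⟶ A}
    (h : IsPullback a b (e.genComp q) (e.polyLift sq x)) {l : W ⟶ D} (hd : l ≫ d = b)
    (ht : l ≫ t = a ≫ pullback.fst (e.polyEv X) q ≫ (e.polyTot X).hom) :
    IsPullback (a ≫ pullback.snd (e.polyEv X) q) l q x := by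
  subst hd
  have w : a ≫ pullback.fst (e.polyEv X) q = l ≫ e.toPolyTot sq x := by
    apply (e.isPullback_poly X).hom_ext
    · simpa [genComp] using h.w
    · simp [ht]
  have := (IsPullback.of_bot h w (e.isPullback_toPolyTot sq x)).paste_horiz
    (IsPullback.of_hasPullback (e.polyEv X) q).flip
  simpa using this

end

/-! ### Stability of exponentiable maps under pullback. -/

section PullbackOfExponentiable

variable {E' B' : C} {f' : E' ⟶ B'} {t : E' ⟶ E} {n : B' ⟶ B} (sq : IsPullback t f' f n)

include sq in
lemma isPullback_ofIsPullback (A : Over B') :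
    IsPullback (pullback.fst A.hom f') (pullback.snd A.hom f' ≫ t) (A.hom ≫ n) f :=
  ((IsPullback.of_hasPullback A.hom f').flip.paste_horiz sq).flip

/-- The pushforward along a pullback `f'` of an exponentiable map `f`. -/
noncomputable def pushObj (X : Over E') : Over B' :=
  -- The second map names the identity of `E'`. A map from `A` into this pullback is thus a map from
  -- the pullback of `A` to `X.left` whose composite with `X.hom` is the projection to `E'`, that
  -- is, a map over `E'`.
  Over.mk (pullback.snd (e.polyMap X.hom) (e.polyLift sq.flip (𝟙 E')))

/-- The projection from `pushObj` to the value of the polynomial functor. -/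
noncomputable def pushFst (X : Over E') : (e.pushObj sq X).left ⟶ (e.polyObj X.left).left :=
  pullback.fst _ _

lemma isPullback_push (X : Over E') : IsPullback (e.pushFst sq X) (e.pushObj sq X).hom
    (e.polyMap X.hom) (e.polyLift sq.flip (𝟙 E')) :=
  IsPullback.of_hasPullback _ _

lemma comp_polyLift_id (A : Over B') :
    A.hom ≫ e.polyLift sq.flip (𝟙 E') =
      e.polyLift (isPullback_ofIsPullback sq A) (pullback.snd A.hom f') := by
  rw [e.comp_polyLift sq.flip (𝟙 E') (isPullback_ofIsPullback sq A) A.hom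
    (pullback.snd A.hom f') rfl pullback.condition.symm rfl, Category.comp_id]

lemma pushObj_w {A : Over B'} {X : Over E'} (v : A ⟶ e.pushObj sq X) :
    (v.left ≫ e.pushFst sq X) ≫ e.polyMap X.hom = A.hom ≫ e.polyLift sq.flip (𝟙 E') := by
  rw [Category.assoc, (e.isPullback_push sq X).w, ← Category.assoc, Over.w]

lemma pushObj_hom {A : Over B'} {X : Over E'} (v : A ⟶ e.pushObj sq X) :
    (v.left ≫ e.pushFst sq X) ≫ (e.polyObj _).hom = A.hom ≫ n := by
  rw [← e.polyMap_hom X.hom, ← Category.assoc, pushObj_w, Category.assoc, polyLift_hom]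

/-- The transpose of a map out of a pullback. -/
noncomputable def pushCurry {A : Over B'} {X : Over E'} (u : (Over.pullback f').obj A ⟶ X) :
    A ⟶ e.pushObj sq X :=
  Over.homMk ((e.isPullback_push sq X).lift (e.polyLift (isPullback_ofIsPullback sq A) u.left)
    A.hom (by
      rw [polyLift_polyMap, e.comp_polyLift_id sq]
      exact congrArg _ (Over.w u))) (IsPullback.lift_snd _ _ _ _)

@[simp]
lemma pushCurry_fst {A : Over B'} {X : Over E'} (u : (Over.pullback f').obj A ⟶ X) :
    (e.pushCurry sq u).left ≫ e.pushFst sq X =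
      e.polyLift (isPullback_ofIsPullback sq A) u.left :=
  IsPullback.lift_fst _ _ _ _

/-- The universal property of `pushObj`. -/
noncomputable def pushEquiv (A : Over B') (X : Over E') :
    ((Over.pullback f').obj A ⟶ X) ≃ (A ⟶ e.pushObj sq X) where
  toFun u := e.pushCurry sq u
  invFun v := Over.homMk (e.eval (v.left ≫ e.pushFst sq X) (pullback.fst A.hom f')
      (pullback.snd A.hom f' ≫ t) (by
        rw [e.pushObj_hom, (isPullback_ofIsPullback sq A).w])) (by
      have w : pullback.fst A.hom f' ≫
          e.polyLift (isPullback_ofIsPullback sq A) (pullback.snd A.hom f') ≫ (e.polyObj _).hom =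
          (pullback.snd A.hom f' ≫ t) ≫ f := by
        rw [polyLift_hom, (isPullback_ofIsPullback sq A).w]
      refine Eq.trans ?_ (e.eval_polyLift (isPullback_ofIsPullback sq A)
        (pullback.snd A.hom f') w)
      have h := (e.pushObj_w sq v).trans (e.comp_polyLift_id sq A)
      rw [← eval_polyMap]
      · exact e.eval_congr h rfl rfl _
      · rw [h, w])
  left_inv u := by
    ext
    exact (e.eval_congr (e.pushCurry_fst sq u) rfl rfl (by
      rw [e.pushObj_hom, (isPullback_ofIsPullback sq A).w])).trans (e.eval_polyLift _ _ (by
      rw [polyLift_hom, (isPullback_ofIsPullback sq A).w]))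
  right_inv v := by
    ext
    apply (e.isPullback_push sq X).hom_ext
    · rw [pushCurry_fst]
      exact e.polyLift_eval _ _ (e.pushObj_hom sq v)
    · rw [Over.w, Over.w]

lemma pushCurry_comp {A A' : Over B'} {X : Over E'} (g : A' ⟶ A)
    (u : (Over.pullback f').obj A ⟶ X) :
    e.pushCurry sq ((Over.pullback f').map g ≫ u) = g ≫ e.pushCurry sq u := by
  ext
  apply (e.isPullback_push sq X).hom_ext
  · have h : (g ≫ e.pushCurry sq u).left ≫ e.pushFst sq X =
        g.left ≫ (e.pushCurry sq u).left ≫ e.pushFst sq X := by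
      rw [Over.comp_left, Category.assoc]
    rw [h, pushCurry_fst, pushCurry_fst]
    refine (e.comp_polyLift _ _ _ _ _ ?_ ?_ ?_).symm
    · simp
    · exact pullback.lift_fst _ _ _
    · exact (Category.assoc _ _ _).symm.trans (congrArg (· ≫ t) (pullback.lift_snd _ _ _))
  · rw [Over.w, Over.w]

/-- A pullback of an exponentiable map is exponentiable. -/
@[reducible]
noncomputable def ofIsPullback : ExpStr f' :=
  letI := ChosenPullbacksAlong.ofHasPullbacksAlong f'
  { chosen := ChosenPullbacksAlong.ofHasPullbacksAlong f'
    expo :=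
      { pushforward := Adjunction.rightAdjointOfEquiv (F := Over.pullback f')
          (fun A X => e.pushEquiv sq A X) (fun _ _ _ g u => e.pushCurry_comp sq g u)
        pullbackPushforwardAdj := Adjunction.adjunctionOfEquivRight _ _ } }

end PullbackOfExponentiable

end ExpStr

end Polynomial

attribute [local simp] pullback.lift_fst pullback.lift_snd pullback.lift_fst_assoc
  pullback.lift_snd_assoc

/-! ### Calculus of lifting structures. -/

section Lifting

variable {C : Type u} [Category.{v} C]

/-- The identity base change. -/
def BaseChange.refl {Y E B : C} (s : Y ⟶ E) (e : E ⟶ B) : BaseChange s e where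
  B' := B
  E' := E
  Y' := Y
  f := 𝟙 B
  e' := e
  s' := s
  g := 𝟙 E
  h := 𝟙 Y
  isPullback_e := IsPullback.id_horiz e
  isPullback_s := IsPullback.id_horiz s

namespace LiftStr

variable {Y E B X Z : C} {s : Y ⟶ E} {e : E ⟶ B} {p : X ⟶ Z}

lemma fill_congr (L : LiftStr s e p) (c : BaseChange s e) {a a' : c.Y' ⟶ X} {b b' : c.E' ⟶ Z}
    (ha : a = a') (hb : b = b') (w : a ≫ p = c.s' ≫ b) :
    L.fill c a b w = L.fill c a' b' (by rw [← ha, ← hb, w]) := by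
  subst ha hb; rfl

/-- A lifting structure against `π` induces one against each map with a fibrancy structure. -/
noncomputable def ofFib {T U : C} {π : T ⟶ U} (L : LiftStr s e π) (F : FibStr π p) :
    LiftStr s e p where
  fill c a b w := F.isPullback.lift (L.fill c (a ≫ F.point) (b ≫ F.name) (by
    rw [Category.assoc, F.isPullback.w, reassoc_of% w])) b (L.fill_right ..)
  fill_left c a b w := by
    apply F.isPullback.hom_ext
    · rw [Category.assoc, IsPullback.lift_fst, L.fill_left]
    · rw [Category.assoc, IsPullback.lift_snd, w]
  fill_right c a b w := IsPullback.lift_snd _ _ _ _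
  natural φ a b w := by
    apply F.isPullback.hom_ext
    · simp only [Category.assoc, IsPullback.lift_fst]
      rw [L.natural φ (a ≫ F.point) (b ≫ F.name)]
    · simp only [Category.assoc, IsPullback.lift_snd]

end LiftStr

/-! ### Composition of lifting structures and change of base object. -/

section Composition

variable [HasPullbacks C] {Y E F B A X Z : C} {s : Y ⟶ E} {s' : E ⟶ F} {e : F ⟶ B} {p : X ⟶ Z}

/-- The first factor of a base change of a composite. -/
noncomputable def BaseChange.fstFactor (c : BaseChange (s ≫ s') e) : BaseChange s (s' ≫ e) where
  B' := c.B'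
  E' := pullback s' c.g
  Y' := c.Y'
  f := c.f
  e' := pullback.snd s' c.g ≫ c.e'
  s' := pullback.lift (c.h ≫ s) c.s' (by rw [Category.assoc, c.isPullback_s.w])
  g := pullback.fst s' c.g
  h := c.h
  isPullback_e := (IsPullback.of_hasPullback s' c.g).paste_vert c.isPullback_e
  isPullback_s := IsPullback.of_bot (by simpa using c.isPullback_s) (by simp)
    (IsPullback.of_hasPullback s' c.g)

/-- The second factor of a base change of a composite. -/
noncomputable def BaseChange.sndFactor (c : BaseChange (s ≫ s') e) : BaseChange s' e where
  B' := c.B'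
  E' := c.E'
  Y' := pullback s' c.g
  f := c.f
  e' := c.e'
  s' := pullback.snd s' c.g
  g := c.g
  h := pullback.fst s' c.g
  isPullback_e := c.isPullback_e
  isPullback_s := IsPullback.of_hasPullback s' c.g

lemma BaseChange.fstFactor_s' (c : BaseChange (s ≫ s') e) :
    c.fstFactor.s' ≫ pullback.snd s' c.g = c.s' :=
  pullback.lift_snd _ _ _

lemma BaseChange.fstFactor_w (c : BaseChange (s ≫ s') e) {a : c.Y' ⟶ X} {b : c.E' ⟶ Z}
    (w : a ≫ p = c.s' ≫ b) : a ≫ p = c.fstFactor.s' ≫ pullback.snd s' c.g ≫ b :=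
  w.trans ((congrArg (· ≫ b) c.fstFactor_s'.symm).trans (Category.assoc _ _ _))

noncomputable def BaseChange.Hom.fstFactor {c d : BaseChange (s ≫ s') e} (φ : c.Hom d) :
    c.fstFactor.Hom d.fstFactor where
  t := φ.t
  k := pullback.map s' c.g s' d.g (𝟙 _) φ.k (𝟙 _) (by simp) (by simp [φ.k_g])
  l := φ.l
  t_f := φ.t_f
  k_g := by simp [BaseChange.fstFactor]
  l_h := φ.l_h
  k_e := by simp [BaseChange.fstFactor, φ.k_e]
  l_s := by
    apply pullback.hom_ext <;> simp [BaseChange.fstFactor, φ.l_s, reassoc_of% φ.l_h]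

noncomputable def BaseChange.Hom.sndFactor {c d : BaseChange (s ≫ s') e} (φ : c.Hom d) :
    c.sndFactor.Hom d.sndFactor where
  t := φ.t
  k := φ.k
  l := pullback.map s' c.g s' d.g (𝟙 _) φ.k (𝟙 _) (by simp) (by simp [φ.k_g])
  t_f := φ.t_f
  k_g := φ.k_g
  l_h := by simp [BaseChange.sndFactor]
  k_e := φ.k_e
  l_s := by simp [BaseChange.sndFactor]

/-- Lifting structures compose. -/
noncomputable def LiftStr.comp (L : LiftStr s (s' ≫ e) p) (L' : LiftStr s' e p) :
    LiftStr (s ≫ s') e p where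
  -- The inner filler solves the problem on the intermediate object, the pullback of `s'`; it is
  -- then the upper side of the problem for the second factor.
  fill c a b w := L'.fill c.sndFactor (L.fill c.fstFactor a (pullback.snd s' c.g ≫ b)
    (c.fstFactor_w w)) b (L.fill_right ..)
  fill_left c a b w := by
    have h := L'.fill_left c.sndFactor (L.fill c.fstFactor a (pullback.snd s' c.g ≫ b)
      (c.fstFactor_w w)) b (L.fill_right ..)
    exact (congrArg (· ≫ _) c.fstFactor_s'.symm).trans <| (Category.assoc _ _ _).trans <|
      (congrArg (c.fstFactor.s' ≫ ·) h).trans (L.fill_left ..)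
  fill_right c a b w := L'.fill_right ..
  natural {c d} φ a b w := by
    refine Eq.trans ?_ (L'.natural φ.sndFactor _ _ (L.fill_right d.fstFactor a
      (pullback.snd s' d.g ≫ b) (d.fstFactor_w w)))
    refine L'.fill_congr _ ?_ rfl _
    refine Eq.trans ?_ (L.natural φ.fstFactor a (pullback.snd s' d.g ≫ b)
      (d.fstFactor_w w))
    refine L.fill_congr _ rfl ?_ _
    exact ((pullback.lift_snd_assoc _ _ _ _).trans (Category.assoc _ _ _)).symm

/-- A base change along a map `f : B' ⟶ A`, regarded as one along its pullback to `B`. -/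
noncomputable def BaseChange.overBase {t : B ⟶ A} {s : Y ⟶ E} {e : E ⟶ B}
    (c : BaseChange s (e ≫ t)) : BaseChange s e where
  B' := pullback t c.f
  E' := c.E'
  Y' := c.Y'
  f := pullback.fst t c.f
  e' := pullback.lift (c.g ≫ e) c.e' (by rw [Category.assoc, c.isPullback_e.w])
  s' := c.s'
  g := c.g
  h := c.h
  isPullback_e := IsPullback.of_bot (by simpa using c.isPullback_e) (by simp)
    (IsPullback.of_hasPullback t c.f)
  isPullback_s := c.isPullback_s

noncomputable def BaseChange.Hom.overBase {t : B ⟶ A} {s : Y ⟶ E} {e : E ⟶ B}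
    {c d : BaseChange s (e ≫ t)} (φ : c.Hom d) : c.overBase.Hom d.overBase where
  t := pullback.map t c.f t d.f (𝟙 _) φ.t (𝟙 _) (by simp) (by simp [φ.t_f])
  k := φ.k
  l := φ.l
  t_f := by simp [BaseChange.overBase]
  k_g := φ.k_g
  l_h := φ.l_h
  k_e := by
    apply pullback.hom_ext <;> simp [BaseChange.overBase, φ.k_e, reassoc_of% φ.k_g]
  l_s := φ.l_s

/-- A lifting structure over `B` induces one over the codomain of each map out of `B`. -/
noncomputable def LiftStr.overBase {s : Y ⟶ E} {e : E ⟶ B} (L : LiftStr s e p) (t : B ⟶ A) :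
    LiftStr s (e ≫ t) p where
  -- The base change of `s` itself is untouched; only the base it is regarded over becomes the
  -- pullback to `B`.
  fill c a b w := L.fill c.overBase a b w
  fill_left c a b w := L.fill_left c.overBase a b w
  fill_right c a b w := L.fill_right c.overBase a b w
  natural φ a b w := L.natural φ.overBase a b w

/-- Lifting structures are invariant under equality of the structure map to the base. -/
def LiftStr.cast {s : Y ⟶ E} {e e' : E ⟶ B} (L : LiftStr s e p) (h : e = e') : LiftStr s e' p :=
  h ▸ L

end Composition

/-! ### Frobenius -/

section Frobenius

variable [HasFiniteLimits C] {Y E B D Y_D T U : C} {s : Y ⟶ E} {e : E ⟶ B} {q : D ⟶ E}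
  {s_D : Y_D ⟶ D} {h : Y_D ⟶ Y} (sq : IsPullback h s_D s q) {π : T ⟶ U} (F : FibStr π q)
  (c : BaseChange s_D (q ≫ e))

/-- The base change of `s` with the same base as a given base change of a pullback of `s`. -/
noncomputable def BaseChange.below (s : Y ⟶ E) (c : BaseChange s_D (q ≫ e)) : BaseChange s e where
  B' := c.B'
  E' := pullback e c.f
  Y' := pullback s (pullback.fst e c.f)
  f := c.f
  e' := pullback.snd e c.f
  s' := pullback.snd s (pullback.fst e c.f)
  g := pullback.fst e c.f
  h := pullback.fst s (pullback.fst e c.f)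
  isPullback_e := IsPullback.of_hasPullback _ _
  isPullback_s := IsPullback.of_hasPullback _ _

noncomputable def BaseChange.Hom.below {c d : BaseChange s_D (q ≫ e)} (φ : c.Hom d) :
    (c.below s).Hom (d.below s) where
  t := φ.t
  k := pullback.map e c.f e d.f (𝟙 _) φ.t (𝟙 _) (by simp) (by simp [φ.t_f])
  l := pullback.map _ _ _ _ (𝟙 _) (pullback.map e c.f e d.f (𝟙 _) φ.t (𝟙 _) (by simp)
    (by simp [φ.t_f])) (𝟙 _) (by simp) (by simp)
  t_f := φ.t_f
  k_g := by simp [BaseChange.below]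
  l_h := by simp [BaseChange.below]
  k_e := by simp [BaseChange.below]
  l_s := by simp [BaseChange.below]

noncomputable def BaseChange.toBelowE : c.E' ⟶ (c.below s).E' :=
  pullback.lift (c.g ≫ q) c.e' (by rw [Category.assoc, c.isPullback_e.w])

@[simp]
lemma BaseChange.toBelowE_g : c.toBelowE ≫ (c.below s).g = c.g ≫ q := pullback.lift_fst _ _ _

@[simp]
lemma BaseChange.toBelowE_e' : c.toBelowE ≫ (c.below s).e' = c.e' := pullback.lift_snd _ _ _

@[simp]
lemma BaseChange.toBelowE_e'_assoc {Z : C} (k : (c.below s).B' ⟶ Z) :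
    c.toBelowE ≫ (c.below s).e' ≫ k = c.e' ≫ k := by
  exact (Category.assoc _ _ _).symm.trans (congrArg (· ≫ k) c.toBelowE_e')

include sq in
lemma BaseChange.below_w : (c.h ≫ h) ≫ s = (c.s' ≫ c.toBelowE) ≫ (c.below s).g := by
  rw [Category.assoc, sq.w, Category.assoc, toBelowE_g, ← Category.assoc, ← Category.assoc,
    c.isPullback_s.w]

noncomputable def BaseChange.toBelowY : c.Y' ⟶ (c.below s).Y' :=
  pullback.lift (c.h ≫ h) (c.s' ≫ c.toBelowE) (c.below_w sq)

@[simp]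
lemma BaseChange.toBelowY_h : c.toBelowY sq ≫ (c.below s).h = c.h ≫ h := pullback.lift_fst _ _ _

@[simp]
lemma BaseChange.toBelowY_s' : c.toBelowY sq ≫ (c.below s).s' = c.s' ≫ c.toBelowE :=
  pullback.lift_snd _ _ _

@[simp]
lemma BaseChange.toBelowY_s'_assoc {Z : C} (k : _ ⟶ Z) :
    c.toBelowY sq ≫ (c.below s).s' ≫ k = c.s' ≫ c.toBelowE ≫ k := by
  rw [← Category.assoc, BaseChange.toBelowY_s', Category.assoc]

lemma BaseChange.isPullback_toBelowE : IsPullback c.g c.toBelowE q (c.below s).g :=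
  IsPullback.of_bot (by rw [toBelowE_e']; exact c.isPullback_e) (by simp)
    (c.below s).isPullback_e

lemma BaseChange.isPullback_toBelowY :
    IsPullback (c.toBelowY sq) c.s' (c.below s).s' c.toBelowE :=
  IsPullback.of_right (by simpa using c.isPullback_s.paste_horiz sq) (by simp)
    (c.below s).isPullback_s

/-- Presents `c.E'` as a pullback of `π` over `(c.below s).E'`, so that maps out of `c.E'` transpose
to maps from `(c.below s).E'` into a polynomial. -/
lemma BaseChange.isPullback_nameE :
    IsPullback c.toBelowE (c.g ≫ F.point) ((c.below s).g ≫ F.name) π :=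
  (c.isPullback_toBelowE.paste_horiz F.isPullback).flip

lemma BaseChange.isPullback_nameY :
    IsPullback (c.toBelowY sq) (c.s' ≫ c.g ≫ F.point) ((c.below s).s' ≫ (c.below s).g ≫ F.name)
      π :=
  ((c.isPullback_toBelowY sq).flip.paste_horiz (c.isPullback_nameE F).flip).flip

lemma BaseChange.Hom.toBelowE {c d : BaseChange s_D (q ≫ e)} (φ : c.Hom d) :
    φ.k ≫ d.toBelowE = c.toBelowE ≫ (φ.below (s := s)).k := by
  apply (d.below s).isPullback_e.hom_ext
  · simp [(φ.below (s := s)).k_g, reassoc_of% φ.k_g]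
  · simp only [Category.assoc, (φ.below (s := s)).k_e, BaseChange.toBelowE_e',
      BaseChange.toBelowE_e'_assoc]
    exact φ.k_e

lemma BaseChange.Hom.toBelowY {c d : BaseChange s_D (q ≫ e)} (φ : c.Hom d) :
    φ.l ≫ d.toBelowY sq = c.toBelowY sq ≫ (φ.below (s := s)).l := by
  apply (d.below s).isPullback_s.hom_ext
  · simp [(φ.below (s := s)).l_h, reassoc_of% φ.l_h]
  · simp [(φ.below (s := s)).l_s, reassoc_of% φ.l_s, φ.toBelowE]

variable (x : ExpStr π) (S : FibStr π (x.polyMap π)) (L : LiftStr s e π)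

/-- The lifting problem of `s_D` against `π` transposes to one of `s` against `x.polyMap π`, which
is a fibration by the Π-type structure. -/
lemma frobenius_w (a : c.Y' ⟶ T) (b : c.E' ⟶ U) (w : a ≫ π = c.s' ≫ b) :
    x.polyLift (c.isPullback_nameY sq F) a ≫ x.polyMap π =
      (c.below s).s' ≫ x.polyLift (c.isPullback_nameE F) b := by
  rw [x.polyLift_polyMap, w]
  exact (x.comp_polyLift _ _ _ _ _ rfl (c.toBelowY_s' sq).symm rfl).symm

/-- The transpose of a filler for a pullback of `s` along a fibration. -/
noncomputable def frobeniusFill (a : c.Y' ⟶ T) (b : c.E' ⟶ U) (w : a ≫ π = c.s' ≫ b) :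
    (c.below s).E' ⟶ (x.polyObj T).left :=
  (L.ofFib S).fill (c.below s) _ _ (frobenius_w sq F c x a b w)

lemma frobeniusFill_hom (a : c.Y' ⟶ T) (b : c.E' ⟶ U) (w : a ≫ π = c.s' ≫ b) :
    frobeniusFill sq F c x S L a b w ≫ (x.polyObj T).hom = (c.below s).g ≫ F.name := by
  rw [← x.polyMap_hom π, ← Category.assoc, frobeniusFill, LiftStr.fill_right, x.polyLift_hom]

/-- Pullbacks along fibrations preserve lifting structures. -/
noncomputable def LiftStr.frobenius : LiftStr s_D (q ≫ e) π where
  -- Transposing back: the filler found below is evaluated at the point of the fibre given by `F`.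
  fill c a b w := x.eval (frobeniusFill sq F c x S L a b w) c.toBelowE (c.g ≫ F.point) (by
    rw [frobeniusFill_hom, (c.isPullback_nameE F).w])
  fill_left c a b w := by
    have h := x.eval_polyLift (c.isPullback_nameY sq F) a
      (by rw [x.polyLift_hom, (c.isPullback_nameY sq F).w])
    rw [x.comp_eval]
    conv_rhs => rw [← h]
    refine (x.eval_congr rfl (c.toBelowY_s' sq).symm rfl _).trans ?_
    rw [← x.eval_comp]
    · refine x.eval_congr ?_ rfl rfl _
      exact LiftStr.fill_left ..
    · rw [Category.assoc, frobeniusFill_hom, (c.isPullback_nameY sq F).w]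
  fill_right c a b w := by
    have h := x.eval_polyLift (c.isPullback_nameE (s := s) F) b
      (by rw [x.polyLift_hom, (c.isPullback_nameE F).w])
    rw [← x.eval_polyMap]
    · refine (x.eval_congr ?_ rfl rfl _).trans h
      exact LiftStr.fill_right ..
    · rw [Category.assoc, x.polyMap_hom, frobeniusFill_hom, (c.isPullback_nameE F).w]
  natural {c d} φ a b w := by
    have h : frobeniusFill sq F c x S L (φ.l ≫ a) (φ.k ≫ b)
        (by rw [Category.assoc, w, reassoc_of% φ.l_s]) =
        (φ.below (s := s)).k ≫ frobeniusFill sq F d x S L a b w := by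
      refine Eq.trans ?_ ((L.ofFib S).natural (φ.below (s := s)) _ _
        (frobenius_w sq F d x a b w))
      refine LiftStr.fill_congr _ _ ?_ ?_ _
      · refine (x.comp_polyLift _ _ _ _ _ ?_ (φ.toBelowY sq) ?_).symm
        · rw [← Category.assoc, (φ.below (s := s)).l_s, Category.assoc, ← Category.assoc _ _ F.name,
            (φ.below (s := s)).k_g]
        · rw [← Category.assoc, φ.l_s, Category.assoc, ← Category.assoc _ _ F.point, φ.k_g]
      · refine (x.comp_polyLift _ _ _ _ _ ?_ φ.toBelowE ?_).symm
        · rw [← Category.assoc, (φ.below (s := s)).k_g]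
        · rw [← Category.assoc, φ.k_g]
    rw [x.comp_eval]
    refine (x.eval_congr h rfl rfl _).trans ?_
    rw [x.eval_comp]
    refine x.eval_congr rfl φ.toBelowE.symm ?_ _
    rw [← Category.assoc, φ.k_g]

end Frobenius

/-! ### Fibrations and identity types -/

section Types

variable [HasFiniteLimits C] {T U : C} {π : T ⟶ U}

/-- Fibrations compose. -/
noncomputable def FibStr.comp (x : ExpStr π) (S : FibStr π (x.genComp π)) {D E B : C} {q : D ⟶ E}
    {p : E ⟶ B} (G : FibStr π q) (F : FibStr π p) : FibStr π (q ≫ p) :=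
  S.pull (x.isPullback_genComp F.isPullback.flip G.name G.isPullback)

variable [ChosenPullbacksAlong π] {E B : C} {p : E ⟶ B} (F : FibStr π p)

/-- The map `E ×_B E ⟶ T ×_U T` induced by a fibrancy structure. -/
noncomputable def FibStr.prodPoint : pullback p p ⟶ pullback π π :=
  pullback.map p p π π F.point F.point F.name F.isPullback.w.symm F.isPullback.w.symm

lemma FibStr.isPullback_prodPoint : IsPullback F.prodPoint (pullback.fst p p ≫ p)
    (pullback.fst π π ≫ π) F.name := by
  refine IsPullback.paste_vert (IsPullback.of_right (h₁₂ := pullback.snd π π) (h₂₂ := π) (v₁₃ := π)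
    ?_ ?_ (IsPullback.of_hasPullback π π).flip) F.isPullback
  · simpa [FibStr.prodPoint, F.isPullback.w] using
      (IsPullback.of_hasPullback p p).flip.paste_horiz F.isPullback
  · simp [FibStr.prodPoint]

namespace PreIdStr

variable (S : PreIdStr π)

lemma nameOf_eq : S.nameOf F = F.prodPoint ≫ S.Id := by
  rfl

lemma isPullback_ev : IsPullback (S.var F) (S.ev F) π (S.nameOf F) :=
  (ChosenPullbacksAlong.isPullback (S.nameOf F) π).flip

/-- The fibrancy structure of an identity type. -/
noncomputable def fibEv : FibStr π (S.ev F) where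
  name := S.nameOf F
  point := S.var F
  isPullback := S.isPullback_ev F

/-- The map from an identity type to the generic one. -/
noncomputable def toGen : S.obj F ⟶ S.genObj :=
  S.isPullback_gen.lift (S.ev F ≫ F.prodPoint) (S.var F) (by
    rw [Category.assoc, ← nameOf_eq, (S.isPullback_ev F).w])

@[simp]
lemma toGen_ev : S.toGen F ≫ S.genEv = S.ev F ≫ F.prodPoint := IsPullback.lift_fst _ _ _ _

@[simp]
lemma toGen_var : S.toGen F ≫ S.genVar = S.var F := IsPullback.lift_snd _ _ _ _

/-- Both identity types are pullbacks of `π` along their names, and the name for `p` is the generic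
one precomposed with `F.prodPoint`. -/
lemma isPullback_toGen : IsPullback (S.toGen F) (S.ev F) S.genEv F.prodPoint :=
  IsPullback.of_right (by rw [toGen_var, ← nameOf_eq]; exact S.isPullback_ev F) (by simp)
    S.isPullback_gen.flip

/-- The reflexivity map of a fibration as a base change of the generic one. -/
noncomputable def reflBaseChange :
    BaseChange S.genRefl (S.genEv ≫ pullback.fst π π ≫ π) where
  B' := B
  E' := S.obj F
  Y' := E
  f := F.name
  e' := S.ev F ≫ pullback.fst p p ≫ p
  s' := S.refl F
  g := S.toGen F
  h := F.point
  isPullback_e := (S.isPullback_toGen F).paste_vert F.isPullback_prodPoint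
  isPullback_s := by
    -- The composites of the two reflexivity maps down to the bases are `p` and `π`, so the outer
    -- rectangle is the fibrancy square of `p`.
    refine IsPullback.of_bot ?_ ?_ ((S.isPullback_toGen F).paste_vert F.isPullback_prodPoint)
    · have h₁ : S.genRefl ≫ S.genEv ≫ pullback.fst π π ≫ π = π := by
        rw [← Category.assoc, genRefl_ev, ← Category.assoc, pullback.diagonal_fst,
          Category.id_comp]
      have h₂ : S.refl F ≫ S.ev F ≫ pullback.fst p p ≫ p = p := by
        rw [← Category.assoc, refl_ev, ← Category.assoc, pullback.diagonal_fst,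
          Category.id_comp]
      rw [h₁, h₂]
      exact F.isPullback
    · apply S.isPullback_gen.hom_ext
      · rw [Category.assoc, Category.assoc, genRefl_ev, toGen_ev, ← Category.assoc, refl_ev]
        apply pullback.hom_ext <;> simp [FibStr.prodPoint]
      · simp

end PreIdStr

/-- The elimination structure of the identity type of a fibration. -/
noncomputable def IdStr.liftRefl (S : IdStr π) :
    LiftStr (S.refl F) (S.ev F ≫ pullback.fst p p ≫ p) π :=
  S.J.restrict (S.reflBaseChange F)

end Types

end Lifting

/-! ### Transport, and lifting for the resulting inclusion of identity types. -/

section Transport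

variable {C : Type u} [Category.{v} C] [HasFiniteLimits C] {T U : C} {π : T ⟶ U}
  {A K R B : C} {q : A ⟶ K} (F : FibStr π q)

/-- The section over `ρ` of the pullback of `q` along a retraction `d` of `ρ`. -/
noncomputable def sectionOver (q : A ⟶ K) {d : R ⟶ K} {ρ : K ⟶ R} (h : ρ ≫ d = 𝟙 K) :
    A ⟶ pullback d q :=
  pullback.lift (q ≫ ρ) (𝟙 A) (by rw [Category.assoc, h, Category.comp_id, Category.id_comp])

section

variable {d : R ⟶ K} {ρ : K ⟶ R} (h : ρ ≫ d = 𝟙 K)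

@[simp]
lemma sectionOver_fst : sectionOver q h ≫ pullback.fst d q = q ≫ ρ := pullback.lift_fst _ _ _

@[simp]
lemma sectionOver_fst_assoc {Z : C} (k : _ ⟶ Z) :
    sectionOver q h ≫ pullback.fst d q ≫ k = q ≫ ρ ≫ k := by
  rw [← Category.assoc, sectionOver_fst, Category.assoc]

@[simp]
lemma sectionOver_snd : sectionOver q h ≫ pullback.snd d q = 𝟙 A := pullback.lift_snd _ _ _

@[simp]
lemma sectionOver_snd_assoc {Z : C} (k : _ ⟶ Z) :
    sectionOver q h ≫ pullback.snd d q ≫ k = k := by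
  rw [← Category.assoc, sectionOver_snd, Category.id_comp]

lemma isPullback_sectionOver : IsPullback q (sectionOver q h) ρ (pullback.fst d q) :=
  (IsPullback.of_right (by rw [sectionOver_snd, h]; exact IsPullback.id_horiz q) (by simp)
    (IsPullback.of_hasPullback d q).flip).flip

/-- The pullback of a fibrancy structure. -/
noncomputable def FibStr.pullFst (d : R ⟶ K) : FibStr π (pullback.fst d q) :=
  F.pull (IsPullback.of_hasPullback d q).flip

end

variable {dl dr : R ⟶ K} {ρ : K ⟶ R} (hl : ρ ≫ dl = 𝟙 K) (hr : ρ ≫ dr = 𝟙 K)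

include F in
/-- Transport along a map with a lifting structure. -/
lemma exists_transport (x : ExpStr π) (P : FibStr π (x.polyMap π)) {b : R ⟶ B}
    (L : LiftStr ρ b π) : ∃ tr : pullback dl q ⟶ pullback dr q,
      tr ≫ pullback.fst dr q = pullback.fst dl q ∧ sectionOver q hl ≫ tr = sectionOver q hr := by
  -- The section of `P ⟶ R` over `ρ` is the pullback of `ρ` along this fibration, so it inherits the
  -- lifting structure of `ρ`.
  let L' := (LiftStr.frobenius (isPullback_sectionOver (q := q) hl) (F.pullFst dl) x P L).ofFib
    (F.pullFst dr)
  -- In this lifting problem, the upper side forces transport to be the identity over `ρ` and the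
  -- lower side forces it to lie over `R`.
  have w : sectionOver q hr ≫ pullback.fst dr q = sectionOver q hl ≫ pullback.fst dl q := by simp
  exact ⟨L'.fill (BaseChange.refl _ _) _ _ w, L'.fill_right _ _ _ w,
    L'.fill_left (BaseChange.refl _ _) _ _ w⟩

/-- Pulling back a transport map. -/
lemma exists_transport_comp {R' : C} {dl' dr' : R' ⟶ K} {ρ' : K ⟶ R'} {hl' : ρ' ≫ dl' = 𝟙 K}
    {hr' : ρ' ≫ dr' = 𝟙 K} {tr' : pullback dl' q ⟶ pullback dr' q}
    (tr_over : tr' ≫ pullback.fst dr' q = pullback.fst dl' q)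
    (tr_section : sectionOver q hl' ≫ tr' = sectionOver q hr') {β : R ⟶ R'}
    (hβr : β ≫ dr' = dr) (hρ : ρ ≫ β = ρ') {m : pullback dl q ⟶ pullback dl' q}
    (m_fst : m ≫ pullback.fst dl' q = pullback.fst dl q ≫ β)
    (m_snd : m ≫ pullback.snd dl' q = pullback.snd dl q) :
    ∃ tr : pullback dl q ⟶ pullback dr q, tr ≫ pullback.fst dr q = pullback.fst dl q ∧
      sectionOver q hl ≫ tr = sectionOver q hr ∧
      tr ≫ pullback.snd dr q = m ≫ tr' ≫ pullback.snd dr' q := by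
  have hm : sectionOver q hl ≫ m = sectionOver q hl' := by
    apply pullback.hom_ext
    · rw [Category.assoc, m_fst, sectionOver_fst_assoc, sectionOver_fst, hρ]
    · rw [Category.assoc, m_snd, sectionOver_snd, sectionOver_snd]
  refine ⟨pullback.lift (pullback.fst dl q) (m ≫ tr' ≫ pullback.snd dr' q) ?_,
    pullback.lift_fst _ _ _, ?_, pullback.lift_snd _ _ _⟩
  · rw [Category.assoc, Category.assoc, ← pullback.condition, reassoc_of% tr_over,
      reassoc_of% m_fst, hβr]
  · apply pullback.hom_ext
    · simp
    · simp [reassoc_of% hm, reassoc_of% tr_section]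

variable {W : C} {ml : W ⟶ pullback dl q} {mr : W ⟶ pullback dr q}
  (sq : IsPullback ml mr (pullback.fst dl q) (pullback.fst dr q))

/-- The inclusion of `A ×_K A` as a fibre of a pullback of the two pullbacks of `A`. -/
noncomputable def prodIncl : pullback q q ⟶ W :=
  sq.lift (pullback.fst q q ≫ sectionOver q hl) (pullback.snd q q ≫ sectionOver q hr) (by
    simp [pullback.condition_assoc])

@[simp]
lemma prodIncl_left : prodIncl hl hr sq ≫ ml = pullback.fst q q ≫ sectionOver q hl :=
  IsPullback.lift_fst _ _ _ _

@[simp]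
lemma prodIncl_left_assoc {Z : C} (k : _ ⟶ Z) :
    prodIncl hl hr sq ≫ ml ≫ k = pullback.fst q q ≫ sectionOver q hl ≫ k := by
  rw [← Category.assoc, prodIncl_left, Category.assoc]

@[simp]
lemma prodIncl_right : prodIncl hl hr sq ≫ mr = pullback.snd q q ≫ sectionOver q hr :=
  IsPullback.lift_snd _ _ _ _

@[simp]
lemma prodIncl_right_assoc {Z : C} (k : _ ⟶ Z) :
    prodIncl hl hr sq ≫ mr ≫ k = pullback.snd q q ≫ sectionOver q hr ≫ k := by
  rw [← Category.assoc, prodIncl_right, Category.assoc]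

/-- Over `ρ` both pullbacks of `A` restrict to `A` itself, so their product over `R` restricts to `A
×_K A`. -/
lemma isPullback_prodIncl : IsPullback (prodIncl hl hr sq) (pullback.fst q q ≫ q)
    (ml ≫ pullback.fst dl q) ρ := by
  refine IsPullback.paste_vert (v₁₂ := ml) ?_ (isPullback_sectionOver hl).flip
  refine IsPullback.of_right (h₁₂ := mr) (v₁₃ := pullback.fst dr q) (h₂₂ := pullback.fst dl q)
    ?_ (prodIncl_left hl hr sq) sq.flip
  rw [prodIncl_right, sectionOver_fst]
  exact (IsPullback.of_hasPullback q q).flip.paste_horiz (isPullback_sectionOver hr).flip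

variable [ChosenPullbacksAlong π] (S : IdStr π) {tr : pullback dl q ⟶ pullback dr q}
  (htr : sectionOver q hl ≫ tr = sectionOver q hr)
  {tw : W ⟶ pullback (pullback.fst dr q) (pullback.fst dr q)}
  (tw_fst : tw ≫ pullback.fst _ _ = ml ≫ tr) (tw_snd : tw ≫ pullback.snd _ _ = mr)
  {I : C} {toId : I ⟶ S.obj (F.pullFst dr)} {j : I ⟶ W}
  (sqI : IsPullback toId j (S.ev (F.pullFst dr)) tw)

include htr tw_fst tw_snd in
-- Transport is the identity over `ρ`, so the twist has no effect there: both endpoints keep the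
-- points assigned by `F`. Hence the names of the two identity types agree over `ρ`.
lemma prodIncl_prodPoint :
    (prodIncl hl hr sq ≫ tw) ≫ (F.pullFst dr).prodPoint = F.prodPoint := by
  apply pullback.hom_ext
  · simp [FibStr.prodPoint, reassoc_of% tw_fst, reassoc_of% htr, FibStr.pullFst, FibStr.pull]
  · simp [FibStr.prodPoint, reassoc_of% tw_snd, FibStr.pullFst, FibStr.pull]

include sqI in
lemma isPullback_toId_var : IsPullback (toId ≫ S.var (F.pullFst dr)) j π
    (tw ≫ S.nameOf (F.pullFst dr)) :=
  sqI.paste_horiz (S.isPullback_ev _)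

include htr tw_fst tw_snd in
lemma prodIncl_nameOf :
    prodIncl hl hr sq ≫ tw ≫ S.nameOf (F.pullFst dr) = S.nameOf F := by
  rw [PreIdStr.nameOf_eq, PreIdStr.nameOf_eq, ← Category.assoc, ← Category.assoc,
    prodIncl_prodPoint F hl hr sq htr tw_fst tw_snd]

/-- The inclusion of the identity type of `q` into a pullback of the identity type of `Q`. -/
noncomputable def idIncl : S.obj F ⟶ I :=
  (isPullback_toId_var F S sqI).lift (S.var F) (S.ev F ≫ prodIncl hl hr sq) (by
    rw [Category.assoc, prodIncl_nameOf F hl hr sq S htr tw_fst tw_snd, (S.isPullback_ev F).w])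

lemma idIncl_toId : idIncl F hl hr sq S htr tw_fst tw_snd sqI ≫ toId ≫ S.var (F.pullFst dr) =
    S.var F :=
  IsPullback.lift_fst _ _ _ _

lemma idIncl_ev : idIncl F hl hr sq S htr tw_fst tw_snd sqI ≫ j =
    S.ev F ≫ prodIncl hl hr sq :=
  IsPullback.lift_snd _ _ _ _

/-- Both `S.obj F` and `I` are pullbacks of `π`, and by `prodIncl_nameOf` the name of the former is
the restriction of the name of the latter. -/
lemma isPullback_idIncl : IsPullback (idIncl F hl hr sq S htr tw_fst tw_snd sqI) (S.ev F) j
    (prodIncl hl hr sq) := by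
  refine IsPullback.of_right ?_ (idIncl_ev F hl hr sq S htr tw_fst tw_snd sqI)
    (isPullback_toId_var F S sqI)
  rw [idIncl_toId, prodIncl_nameOf F hl hr sq S htr tw_fst tw_snd]
  exact S.isPullback_ev F

/-- The composite of the reflexivity map with `idIncl` has a lifting structure. -/
noncomputable def liftIdIncl (x : ExpStr π) (G : FibStr π (x.genComp π))
    (P : FibStr π (x.polyMap π)) {b : R ⟶ B} (L : LiftStr ρ b π) :
    LiftStr (S.refl F ≫ idIncl F hl hr sq S htr tw_fst tw_snd sqI)
      ((j ≫ ml ≫ pullback.fst dl q) ≫ b) π :=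
  -- Stacking the two squares exhibits `idIncl` as the base change of `ρ` along `I ⟶ R`.
  have sq' := (isPullback_idIncl F hl hr sq S htr tw_fst tw_snd sqI).paste_vert
    (isPullback_prodIncl hl hr sq)
  have fj : FibStr π j := (S.fibEv (F.pullFst dr)).pull sqI
  have fW : FibStr π (ml ≫ pullback.fst dl q) :=
    FibStr.comp x G ((F.pullFst dr).pull sq.flip) (F.pullFst dl)
  -- The reflexivity factor lifts by `J`, regarded over `B` via `ρ ≫ b`; the inclusion lifts by
  -- Frobenius along the composite fibration `I ⟶ R`.
  LiftStr.comp (((S.liftRefl F).overBase (ρ ≫ b)).cast (by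
      have h := congrArg (· ≫ b) sq'.w
      simp only [Category.assoc] at h ⊢
      exact h.symm))
    (LiftStr.frobenius sq'.flip (FibStr.comp x G fj fW) x P L)

end Transport

/-! ### Componentwise lifting against `τ`. -/

section GluedCategory

variable {C₀ : Type u₀} [Category.{v₀} C₀] [HasFiniteLimits C₀]
  {C₁ : Type u₁} [Category.{v₁} C₁] [HasFiniteLimits C₁] {M : C₀ ⥤ C₁} [PreservesFiniteLimits M]

/-- Since `M` preserves pullbacks, pullbacks in the gluing category are computed componentwise. -/
lemma left_isPullback {P X Y Z : Gl M} {a : P ⟶ X} {b : P ⟶ Y} {f : X ⟶ Z} {g : Y ⟶ Z}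
    (h : IsPullback a b f g) : IsPullback a.left b.left f.left g.left :=
  have : PreservesLimit (cospan f g) (Comma.fst (𝟭 C₁) M) :=
    preservesLimit_of_preserves_limit_cone
      (Comma.coneOfPreservesIsLimit (cospan f g)
        (limit.isLimit (cospan f g ⋙ Comma.fst (𝟭 C₁) M))
        (limit.isLimit (cospan f g ⋙ Comma.snd (𝟭 C₁) M)))
      (IsLimit.ofIsoLimit (limit.isLimit (cospan f g ⋙ Comma.fst (𝟭 C₁) M))
        (Cone.ext (Iso.refl _) (by intro; simp [Comma.coneOfPreserves])))
  h.map (Comma.fst (𝟭 C₁) M)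

section

variable {Y E B : Gl M} {s : Y ⟶ E} {e : E ⟶ B}

/-- The 0-component of a base change. -/
def BaseChange.right (c : BaseChange s e) : BaseChange s.right e.right where
  B' := c.B'.right
  E' := c.E'.right
  Y' := c.Y'.right
  f := c.f.right
  e' := c.e'.right
  s' := c.s'.right
  g := c.g.right
  h := c.h.right
  isPullback_e := right_isPullback c.isPullback_e
  isPullback_s := right_isPullback c.isPullback_s

/-- The 1-component of a base change. -/
def BaseChange.left (c : BaseChange s e) : BaseChange s.left e.left where
  B' := c.B'.left
  E' := c.E'.left
  Y' := c.Y'.left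
  f := c.f.left
  e' := c.e'.left
  s' := c.s'.left
  g := c.g.left
  h := c.h.left
  isPullback_e := left_isPullback c.isPullback_e
  isPullback_s := left_isPullback c.isPullback_s

def BaseChange.Hom.right {c d : BaseChange s e} (φ : c.Hom d) : c.right.Hom d.right where
  t := φ.t.right
  k := φ.k.right
  l := φ.l.right
  t_f := congrArg CommaMorphism.right φ.t_f
  k_g := congrArg CommaMorphism.right φ.k_g
  l_h := congrArg CommaMorphism.right φ.l_h
  k_e := congrArg CommaMorphism.right φ.k_e
  l_s := congrArg CommaMorphism.right φ.l_s

def BaseChange.Hom.left {c d : BaseChange s e} (φ : c.Hom d) : c.left.Hom d.left where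
  t := φ.t.left
  k := φ.k.left
  l := φ.l.left
  t_f := congrArg CommaMorphism.left φ.t_f
  k_g := congrArg CommaMorphism.left φ.k_g
  l_h := congrArg CommaMorphism.left φ.l_h
  k_e := congrArg CommaMorphism.left φ.k_e
  l_s := congrArg CommaMorphism.left φ.l_s

variable {T₀ U₀ : C₀} {π₀ : T₀ ⟶ U₀} (x : ExpStr (M.map π₀)) {T₁ U₁ : C₁} {π₁ : T₁ ⟶ U₁}
  (L₀ : LiftStr s.right e.right π₀) (L₁ : LiftStr s.left e.left π₁)
  (c : BaseChange s e) (a : c.Y' ⟶ tauTot x π₁) (b : c.E' ⟶ tauBase x)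
  (w : a ≫ tau x π₁ = c.s' ≫ b)

/-- The 0-component of a filler. -/
def gluedFillRight : c.E'.right ⟶ T₀ :=
  L₀.fill c.right a.right b.right (congrArg CommaMorphism.right w)

lemma gluedFillRight_left : c.s'.right ≫ gluedFillRight x L₀ c a b w = a.right :=
  L₀.fill_left c.right _ _ _

lemma gluedFillRight_right : gluedFillRight x L₀ c a b w ≫ π₀ = b.right :=
  L₀.fill_right c.right _ _ _

/-- The map to the relative matching object of `τ` determined by the 0-component of a filler. -/
noncomputable def gluedMatch : c.E'.left ⟶ relObj (tau x π₁) :=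
  (isPullback_rel (tau x π₁)).lift b.left (absMatch c.E' ≫ M.map (gluedFillRight x L₀ c a b w)) (by
    rw [absMatch_w b, Category.assoc, ← M.map_comp, gluedFillRight_right])

lemma gluedMatch_fst : gluedMatch x L₀ c a b w ≫ relFst (tau x π₁) = b.left :=
  IsPullback.lift_fst _ _ _ _

lemma gluedMatch_snd : gluedMatch x L₀ c a b w ≫ relSnd (tau x π₁) =
    absMatch c.E' ≫ M.map (gluedFillRight x L₀ c a b w) :=
  IsPullback.lift_snd _ _ _ _

/-- Once the 0-component is filled, what remains is a lifting problem against the relative matching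
map of `τ`, a `π₁`-fibration by `tauFib`. -/
lemma gluedMatch_w : a.left ≫ relMap (tau x π₁) = c.s'.left ≫ gluedMatch x L₀ c a b w := by
  apply rel_hom_ext
  · rw [Category.assoc, Category.assoc, relMap_fst, gluedMatch_fst]
    exact congrArg CommaMorphism.left w
  · rw [Category.assoc, Category.assoc, relMap_snd, gluedMatch_snd, ← Category.assoc _ _ (M.map _),
      absMatch_w c.s', Category.assoc, ← M.map_comp, gluedFillRight_left, absMatch_w a]

/-- The 1-component of a filler. -/
noncomputable def gluedFillLeft : c.E'.left ⟶ (tauTot x π₁).left :=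
  (L₁.ofFib (tauFib x π₁)).fill c.left a.left _ (gluedMatch_w x L₀ c a b w)

lemma gluedFillLeft_left : c.s'.left ≫ gluedFillLeft x L₀ L₁ c a b w = a.left :=
  (L₁.ofFib (tauFib x π₁)).fill_left c.left _ _ _

lemma gluedFillLeft_right : gluedFillLeft x L₀ L₁ c a b w ≫ relMap (tau x π₁) =
    gluedMatch x L₀ c a b w :=
  (L₁.ofFib (tauFib x π₁)).fill_right c.left _ _ _

/-- Lifting structures for the two components of a map give a lifting structure against `τ`. -/
noncomputable def gluedLift : LiftStr s e (tau x π₁) where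
  fill c a b w :=
    { left := gluedFillLeft x L₀ L₁ c a b w
      right := gluedFillRight x L₀ c a b w
      w := by
        have h := relMap_snd (tau x π₁)
        refine (congrArg (_ ≫ ·) h.symm).trans ?_
        refine (Category.assoc _ _ _).symm.trans ?_
        exact (congrArg (· ≫ relSnd (tau x π₁)) (gluedFillLeft_right x L₀ L₁ c a b w)).trans
          (gluedMatch_snd x L₀ c a b w) }
  fill_left c a b w := by
    refine CommaMorphism.ext ?_ ?_
    · exact gluedFillLeft_left x L₀ L₁ c a b w
    · exact gluedFillRight_left x L₀ c a b w
  fill_right c a b w := by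
    ext
    · refine (congrArg (_ ≫ ·) (relMap_fst (tau x π₁)).symm).trans ?_
      refine (Category.assoc _ _ _).symm.trans ?_
      rw [gluedFillLeft_right, gluedMatch_fst]
    · exact gluedFillRight_right x L₀ c a b w
  natural {c d} φ a b w := by
    have hr : gluedFillRight x L₀ c (φ.l ≫ a) (φ.k ≫ b)
        (by rw [Category.assoc, w, reassoc_of% φ.l_s]) =
        φ.k.right ≫ gluedFillRight x L₀ d a b w :=
      L₀.natural φ.right _ _ (congrArg CommaMorphism.right w)
    have w' : (φ.l ≫ a) ≫ tau x π₁ = c.s' ≫ φ.k ≫ b := by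
      rw [Category.assoc, w, reassoc_of% φ.l_s]
    have hm : gluedMatch x L₀ c (φ.l ≫ a) (φ.k ≫ b) w' =
        φ.k.left ≫ gluedMatch x L₀ d a b w := by
      apply rel_hom_ext
      · rw [gluedMatch_fst, Category.assoc, gluedMatch_fst]
        rfl
      · rw [gluedMatch_snd, hr, M.map_comp, ← Category.assoc, ← absMatch_w φ.k, Category.assoc,
          Category.assoc, gluedMatch_snd]
    refine CommaMorphism.ext ?_ ?_
    · exact (LiftStr.fill_congr (L₁.ofFib (tauFib x π₁)) c.left rfl hm
        (gluedMatch_w x L₀ c _ _ w')).trans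
        ((L₁.ofFib (tauFib x π₁)).natural φ.left _ _ (gluedMatch_w x L₀ d a b w))
    · exact hr

end

section Classification

variable {T₀ U₀ : C₀} {π₀ : T₀ ⟶ U₀} (x : ExpStr (M.map π₀)) {T₁ U₁ : C₁} {π₁ : T₁ ⟶ U₁}
  {X Y : Gl M} {f : Y ⟶ X} (G₀ : FibStr π₀ f.right)

/-- Makes the relative matching object a pullback of `M π₀`, so that maps out of it are classified
by maps from `X₁` into a polynomial over `M U₀`. -/
lemma isPullback_relName : IsPullback (relFst f) (relSnd f ≫ M.map G₀.point)
    (absMatch X ≫ M.map G₀.name) (M.map π₀) :=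
  ((isPullback_rel f).flip.paste_horiz (G₀.isPullback.map M)).flip

end Classification

end GluedCategory

/-! ### Relative matching objects over `E ×_B E`, using only a 0-component of reflexivity. -/

section MatchingObjects

variable {C₀ : Type u₀} [Category.{v₀} C₀] [HasFiniteLimits C₀]
  {C₁ : Type u₁} [Category.{v₁} C₁] [HasFiniteLimits C₁] {M : C₀ ⥤ C₁} [PreservesFiniteLimits M]
  {E B I : Gl M} (p : E ⟶ B) (ev : I ⟶ pullback p p)

@[simp]
lemma matchLeft_fst : matchLeft p ev ≫ pullback.fst _ _ = downBase p ev := pullback.lift_fst _ _ _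

@[simp]
lemma matchLeft_fst_assoc {Z : C₁} (k : _ ⟶ Z) :
    matchLeft p ev ≫ pullback.fst _ _ ≫ k = downBase p ev ≫ k := by
  rw [← Category.assoc, matchLeft_fst]

@[simp]
lemma matchLeft_snd : matchLeft p ev ≫ pullback.snd _ _ = relFst ev ≫ (pullback.fst p p).left :=
  pullback.lift_snd _ _ _

@[simp]
lemma matchRight_fst : matchRight p ev ≫ pullback.fst _ _ = downBase p ev :=
  pullback.lift_fst _ _ _

@[simp]
lemma matchRight_snd : matchRight p ev ≫ pullback.snd _ _ = relFst ev ≫ (pullback.snd p p).left :=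
  pullback.lift_snd _ _ _

@[simp]
lemma matchRight_snd_assoc {Z : C₁} (k : _ ⟶ Z) :
    matchRight p ev ≫ pullback.snd _ _ ≫ k = relFst ev ≫ (pullback.snd p p).left ≫ k := by
  rw [← Category.assoc, matchRight_snd, Category.assoc]

/-- A point of `relObj ev` is a pair of points of `E₁` over one point of `B₁`, with a point of `M
I₀` whose two endpoints are their matching data. This is a point of `R` with one point of `P` and
one of `Q` over it. -/
lemma isPullback_match : IsPullback (matchLeft p ev) (matchRight p ev)
    (pullback.fst (endLeft p ev) (relMap p)) (pullback.fst (endRight p ev) (relMap p)) := by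
  have sql := left_isPullback (IsPullback.of_hasPullback p p)
  have sqr := right_isPullback (IsPullback.of_hasPullback p p)
  refine IsPullback.mk' (by simp) ?_ ?_
  · intro Z φ ψ h₁ h₂
    apply rel_hom_ext
    · apply sql.hom_ext
      · have := congrArg (· ≫ pullback.snd _ _) h₁
        simpa using this
      · have := congrArg (· ≫ pullback.snd _ _) h₂
        simpa using this
    · have := congrArg (· ≫ pullback.fst _ _ ≫ relSnd (toBase p ev)) h₁
      simpa using this
  · intro Z a b w
    have hl₁ : a ≫ pullback.snd _ _ ≫ p.left = a ≫ pullback.fst _ _ ≫ relFst (toBase p ev) := by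
      rw [← endLeft_fst, pullback.condition_assoc, relMap_fst]
    have hl₂ : b ≫ pullback.snd _ _ ≫ p.left = b ≫ pullback.fst _ _ ≫ relFst (toBase p ev) := by
      rw [← endRight_fst, pullback.condition_assoc, relMap_fst]
    have hr₁ : a ≫ pullback.snd _ _ ≫ absMatch E =
        a ≫ pullback.fst _ _ ≫ relSnd (toBase p ev) ≫ M.map (ev ≫ pullback.fst p p).right := by
      rw [← endLeft_snd, pullback.condition_assoc, relMap_snd]
    have hr₂ : b ≫ pullback.snd _ _ ≫ absMatch E =
        b ≫ pullback.fst _ _ ≫ relSnd (toBase p ev) ≫ M.map (ev ≫ pullback.snd p p).right := by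
      rw [← endRight_snd, pullback.condition_assoc, relMap_snd]
    let y : Z ⟶ (pullback p p).left := sql.lift (a ≫ pullback.snd _ _) (b ≫ pullback.snd _ _) (by
      rw [Category.assoc, Category.assoc, hl₁, hl₂, reassoc_of% w])
    have hy₁ : y ≫ (pullback.fst p p).left = a ≫ pullback.snd _ _ := sql.lift_fst _ _ _
    have hy₂ : y ≫ (pullback.snd p p).left = b ≫ pullback.snd _ _ := sql.lift_snd _ _ _
    let z : Z ⟶ relObj ev := (isPullback_rel ev).lift y (a ≫ pullback.fst _ _ ≫
        relSnd (toBase p ev)) (by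
      -- `M` preserves the pullback `E₀ ×_{B₀} E₀`, so the matching condition may be checked on the
      -- two endpoints.
      apply (sqr.map M).hom_ext
      · rw [Category.assoc, ← absMatch_w, ← Category.assoc, hy₁, Category.assoc, hr₁]
        simp
      · rw [Category.assoc, ← absMatch_w, ← Category.assoc, hy₂, Category.assoc, hr₂,
          ← reassoc_of% w]
        simp)
    have hz₁ : z ≫ relFst ev = y := IsPullback.lift_fst _ _ _ _
    have hz₂ : z ≫ relSnd ev = a ≫ pullback.fst _ _ ≫ relSnd (toBase p ev) :=
      IsPullback.lift_snd _ _ _ _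
    have hz : z ≫ downBase p ev = a ≫ pullback.fst _ _ := by
      apply rel_hom_ext
      · rw [Category.assoc, downBase_fst, ← Category.assoc, hz₁, Comma.comp_left, ← Category.assoc,
          hy₁, Category.assoc, hl₁, Category.assoc]
      · rw [Category.assoc, downBase_snd, hz₂, Category.assoc]
    refine ⟨z, ?_, ?_⟩
    · apply pullback.hom_ext
      · rw [Category.assoc, matchLeft_fst, hz]
      · rw [Category.assoc, matchLeft_snd, ← Category.assoc, hz₁, hy₁]
    · apply pullback.hom_ext
      · rw [Category.assoc, matchRight_fst, hz, w]
      · rw [Category.assoc, matchRight_snd, ← Category.assoc, hz₁, hy₂]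

variable {r₀ : E.right ⟶ I.right} (h₀ : r₀ ≫ ev.right = (pullback.diagonal p).right)

include h₀ in
lemma comp_toBase_right : r₀ ≫ (toBase p ev).right = p.right := by
  rw [Comma.comp_right, ← Category.assoc, h₀, ← Comma.comp_right, ← Category.assoc,
    pullback.diagonal_fst, Category.id_comp]

/-- The map of relative matching objects induced by a 0-component of a reflexivity map. -/
noncomputable def relReflOf : relObj p ⟶ relObj (toBase p ev) :=
  (isPullback_rel (toBase p ev)).lift (relFst p) (relSnd p ≫ M.map r₀) (by
    rw [(isPullback_rel p).w, Category.assoc, ← M.map_comp, comp_toBase_right p ev h₀])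

@[simp]
lemma relReflOf_fst : relReflOf p ev h₀ ≫ relFst (toBase p ev) = relFst p :=
  IsPullback.lift_fst _ _ _ _

@[simp]
lemma relReflOf_snd : relReflOf p ev h₀ ≫ relSnd (toBase p ev) = relSnd p ≫ M.map r₀ :=
  IsPullback.lift_snd _ _ _ _

@[simp]
lemma relReflOf_snd_assoc {Z : C₁} (k : _ ⟶ Z) :
    relReflOf p ev h₀ ≫ relSnd (toBase p ev) ≫ k = relSnd p ≫ M.map r₀ ≫ k := by
  rw [← Category.assoc, relReflOf_snd, Category.assoc]

lemma relReflOf_endLeft : relReflOf p ev h₀ ≫ endLeft p ev = 𝟙 (relObj p) := by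
  apply rel_hom_ext
  · rw [Category.assoc, endLeft_fst, relReflOf_fst, Category.id_comp]
  · rw [Category.assoc, endLeft_snd, relReflOf_snd_assoc, ← M.map_comp, Comma.comp_right,
      ← Category.assoc, h₀, ← Comma.comp_right, pullback.diagonal_fst, Comma.id_right, M.map_id,
      Category.comp_id, Category.id_comp]

lemma relReflOf_endRight : relReflOf p ev h₀ ≫ endRight p ev = 𝟙 (relObj p) := by
  apply rel_hom_ext
  · rw [Category.assoc, endRight_fst, relReflOf_fst, Category.id_comp]
  · rw [Category.assoc, endRight_snd, relReflOf_snd_assoc, ← M.map_comp, Comma.comp_right,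
      ← Category.assoc, h₀, ← Comma.comp_right, pullback.diagonal_snd, Comma.id_right, M.map_id,
      Category.comp_id, Category.id_comp]

/-- `relReflOf` as a base change of the image of the 0-component of a reflexivity map. -/
noncomputable def relReflBaseChange : BaseChange (M.map r₀) (M.map (toBase p ev).right) where
  B' := B.left
  E' := relObj (toBase p ev)
  Y' := relObj p
  f := absMatch B
  e' := relFst (toBase p ev)
  s' := relReflOf p ev h₀
  g := relSnd (toBase p ev)
  h := relSnd p
  -- Relative matching objects are base changes along `B₁ ⟶ M B₀`; thus a lifting structure for `M
  -- r₀` restricts to one for `relReflOf`.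
  isPullback_e := (isPullback_rel (toBase p ev)).flip
  isPullback_s := by
    refine IsPullback.of_bot ?_ (relReflOf_snd p ev h₀).symm (isPullback_rel (toBase p ev)).flip
    rw [relReflOf_fst, ← M.map_comp, comp_toBase_right p ev h₀]
    exact (isPullback_rel p).flip

end MatchingObjects

/-! ### The factorization determined by a transport map. -/

section Construction

variable {C₀ : Type u₀} [Category.{v₀} C₀] [HasFiniteLimits C₀]
  {C₁ : Type u₁} [Category.{v₁} C₁] [HasFiniteLimits C₁] {M : C₀ ⥤ C₁} [PreservesFiniteLimits M]
  {T₀ U₀ : C₀} {π₀ : T₀ ⟶ U₀} [ChosenPullbacksAlong π₀] {T₁ U₁ : C₁} {π₁ : T₁ ⟶ U₁}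
  [ChosenPullbacksAlong π₁] (S₀ : IdStr π₀) (S₁ : IdStr π₁)
  {E B I : Gl M} {p : E ⟶ B} (F₀ : FibStr π₀ p.right) (F₁ : FibStr π₁ (relMap p))
  {ev : I ⟶ pullback p p} {i₀ : I.right ≅ S₀.obj F₀}
  (hi : i₀.hom ≫ S₀.ev F₀ = ev.right ≫ prodRight p)

include hi in
lemma refl_comp_ev_right :
    (S₀.refl F₀ ≫ i₀.inv) ≫ ev.right = (pullback.diagonal p).right := by
  rw [← cancel_mono (prodRight p), Category.assoc, Category.assoc, ← hi, i₀.inv_hom_id_assoc,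
    PreIdStr.refl_ev, diagonal_right]

include hi in
lemma comp_toBase : i₀.hom ≫ S₀.ev F₀ ≫ pullback.fst p.right p.right ≫ p.right =
    (toBase p ev).right := by
  rw [← Category.assoc, hi, Category.assoc, ← Category.assoc (prodRight p), prodRight_fst]
  simp

/-- The lifting structure of the 0-component of the reflexivity map. -/
noncomputable def liftReflRight : LiftStr (S₀.refl F₀ ≫ i₀.inv) (toBase p ev).right π₀ :=
  (S₀.liftRefl F₀).restrict
    { B' := B.right
      E' := I.right
      Y' := E.right
      f := 𝟙 _
      e' := (toBase p ev).right
      s' := S₀.refl F₀ ≫ i₀.inv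
      g := i₀.hom
      h := 𝟙 _
      isPullback_e := IsPullback.of_horiz_isIso ⟨by rw [comp_toBase S₀ F₀ hi, Category.comp_id]⟩
      isPullback_s := IsPullback.of_horiz_isIso ⟨by simp⟩ }

/-- The fibrancy structure of the 0-component of `ev`. -/
noncomputable def fibEvRight : FibStr π₀ ev.right :=
  (S₀.fibEv F₀).pull (IsPullback.of_horiz_isIso ⟨hi⟩ : IsPullback i₀.hom ev.right (S₀.ev F₀)
    (prodRight p))

/-- The lifting structure of the map of relative matching objects induced by reflexivity. -/
noncomputable def liftRelRefl (x₀ : ExpStr π₀) (G₀ : FibStr π₀ (x₀.genComp π₀))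
    (L : LiftTransfer M π₀ π₁) :
    LiftStr (relReflOf p ev (refl_comp_ev_right S₀ F₀ hi)) (relFst (toBase p ev)) π₁ :=
  -- The transfer applies because `E₀ ⟶ B₀` is a fibration and `I₀ ⟶ B₀` is a composite of `ev₀`, a
  -- projection and `p₀`, a fibration by Σ-types.
  (L.map (S₀.refl F₀ ≫ i₀.inv) (toBase p ev).right
    (by rw [comp_toBase_right p ev (refl_comp_ev_right S₀ F₀ hi)]; exact ⟨F₀⟩)
    ⟨FibStr.comp x₀ G₀ (fibEvRight S₀ F₀ hi)
      (FibStr.comp x₀ G₀ (F₀.pull (right_isPullback (IsPullback.of_hasPullback p p)).flip) F₀)⟩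
    (liftReflRight S₀ F₀ hi)).restrict
    (relReflBaseChange p ev (refl_comp_ev_right S₀ F₀ hi))

variable (x₀ : ExpStr π₀) (G₀ : FibStr π₀ (x₀.genComp π₀)) (L : LiftTransfer M π₀ π₁)
  (x₁ : ExpStr π₁) (G₁ : FibStr π₁ (x₁.genComp π₁))
  (P₁ : FibStr π₁ (x₁.polyMap π₁))
  {tr : pullback (endLeft p ev) (relMap p) ⟶ pullback (endRight p ev) (relMap p)}
  (tr_over : tr ≫ pullback.fst _ _ = pullback.fst _ _)
  (htr : sectionOver (relMap p) (relReflOf_endLeft p ev (refl_comp_ev_right S₀ F₀ hi)) ≫ tr =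
    sectionOver (relMap p) (relReflOf_endRight p ev (refl_comp_ev_right S₀ F₀ hi)))
  {tw : relObj ev ⟶
    pullback (pullback.fst (endRight p ev) (relMap p)) (pullback.fst (endRight p ev) (relMap p))}
  (tw_fst : tw ≫ pullback.fst _ _ = matchLeft p ev ≫ tr)
  (tw_snd : tw ≫ pullback.snd _ _ = matchRight p ev)
  {toId : I.left ⟶ S₁.obj (fibRight F₁ ev)}
  (sqI : IsPullback toId (relMap ev) (S₁.ev (fibRight F₁ ev)) tw)

include G₀ L G₁ P₁ tr_over htr tw_fst tw_snd sqI in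
/-- The factorization determined by a transport map and a pullback of an identity type. -/
lemma exists_idFactorization : ∃ r : E ⟶ I, r.right = S₀.refl F₀ ≫ i₀.inv ∧
    Nonempty (IdFactorization S₀.toPreIdStr S₁.toPreIdStr p F₀ F₁ r ev) ∧
    Nonempty (LiftStr r.left (toBase p ev).left π₁) := by
  have h₀ := refl_comp_ev_right S₀ F₀ hi
  have hl := relReflOf_endLeft p ev h₀
  have hr := relReflOf_endRight p ev h₀
  have sq := isPullback_match p ev
  let incl : S₁.obj F₁ ⟶ I.left := idIncl F₁ hl hr sq S₁ htr tw_fst tw_snd sqI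
  let inclBase : pullback (relMap p) (relMap p) ⟶ relObj ev := prodIncl hl hr sq
  have hincl : incl ≫ relMap ev = S₁.ev F₁ ≫ inclBase :=
    idIncl_ev F₁ hl hr sq S₁ htr tw_fst tw_snd sqI
  have hb₁ : inclBase ≫ relFst ev ≫ (pullback.fst p p).left =
      pullback.fst (relMap p) (relMap p) := by
    rw [← matchLeft_snd, ← Category.assoc, prodIncl_left hl hr sq, Category.assoc,
      sectionOver_snd, Category.comp_id]
  have hb₂ : inclBase ≫ relFst ev ≫ (pullback.snd p p).left =
      pullback.snd (relMap p) (relMap p) := by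
    rw [← matchRight_snd, ← Category.assoc, prodIncl_right hl hr sq, Category.assoc,
      sectionOver_snd, Category.comp_id]
  have hb : inclBase ≫ downBase p ev =
      (pullback.fst (relMap p) (relMap p) ≫ relMap p) ≫ relReflOf p ev h₀ := by
    rw [← matchLeft_fst, ← Category.assoc, prodIncl_left hl hr sq, Category.assoc,
      sectionOver_fst, Category.assoc]
  have hd : (S₁.refl F₁ ≫ incl) ≫ relMap ev = pullback.diagonal (relMap p) ≫ inclBase := by
    rw [Category.assoc, hincl, ← Category.assoc, PreIdStr.refl_ev]
  -- The components are compatible because `inclBase` lies over `relReflOf`, whose `M I₀`-component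
  -- is the image of the 0-component of `r`.
  let r : E ⟶ I :=
    { left := S₁.refl F₁ ≫ incl
      right := S₀.refl F₀ ≫ i₀.inv
      w := by
        change (S₁.refl F₁ ≫ incl) ≫ absMatch I = absMatch E ≫ M.map (S₀.refl F₀ ≫ i₀.inv)
        rw [← relMap_snd ev, ← Category.assoc, hd, Category.assoc, ← downBase_snd,
          ← Category.assoc inclBase, hb, Category.assoc, Category.assoc, relReflOf_snd,
          pullback.diagonal_fst_assoc, ← Category.assoc, relMap_snd] }
  have fac : r ≫ ev = pullback.diagonal p := by
    refine CommaMorphism.ext ?_ h₀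
    have hev : (r ≫ ev).left = pullback.diagonal (relMap p) ≫ inclBase ≫ relFst ev := by
      rw [← Category.assoc, ← hd, Category.assoc, relMap_fst]
      rfl
    apply (left_isPullback (IsPullback.of_hasPullback p p)).hom_ext
    · rw [hev, Category.assoc, Category.assoc, hb₁, pullback.diagonal_fst, ← Comma.comp_left,
        pullback.diagonal_fst]
      rfl
    · rw [hev, Category.assoc, Category.assoc, hb₂, pullback.diagonal_snd, ← Comma.comp_left,
        pullback.diagonal_snd]
      rfl
  refine ⟨r, rfl, ⟨
    { fac := fac
      reedy := ⟨⟨fibEvRight S₀ F₀ hi⟩, ⟨(S₁.fibEv (fibRight F₁ ev)).pull sqI⟩⟩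
      iso₀ := i₀
      iso₀_ev := hi
      refl_iso₀ := by simp [r]
      transport := tr
      transport_over := tr_over
      -- With this `r`, the maps `reflLeft` and `reflRight` are definitionally the two sections over
      -- `relReflOf`.
      transport_refl := htr
      twist := tw
      twist_fst := tw_fst
      twist_snd := tw_snd
      toId := toId
      isPullback_toId := sqI
      inclBase := inclBase
      inclBase_fst := hb₁
      inclBase_snd := hb₂
      isPullback_inclBase := by
        have h := isPullback_prodIncl hl hr sq
        rw [matchLeft_fst] at h
        exact h
      incl := incl
      isPullback_incl := isPullback_idIncl F₁ hl hr sq S₁ htr tw_fst tw_snd sqI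
      incl_toId := idIncl_toId F₁ hl hr sq S₁ htr tw_fst tw_snd sqI
      refl_left := rfl }⟩, ⟨?_⟩⟩
  refine (liftIdIncl F₁ hl hr sq S₁ htr tw_fst tw_snd sqI x₁ G₁ P₁
    (liftRelRefl S₀ F₀ hi x₀ G₀ L)).cast ?_
  rw [matchLeft_fst, Category.assoc, downBase_fst, ← Category.assoc, relMap_fst, Comma.comp_left]
  rfl

end Construction

/-! ### Comparison of objects over `E ×_B E` with isomorphic 0-components. -/

section Comparison

variable {C₀ : Type u₀} [Category.{v₀} C₀] [HasFiniteLimits C₀]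
  {C₁ : Type u₁} [Category.{v₁} C₁] [HasFiniteLimits C₁] {M : C₀ ⥤ C₁}

/-- The relative matching object sees `Y` only through `M Y₀`: the map is a base change of `M.map
k.right`. -/
lemma isIso_relOver {X Y Y' : Gl M} (k : Y ⟶ Y') (f : Y ⟶ X) (f' : Y' ⟶ X) (h : k ≫ f' = f)
    [IsIso k.right] : IsIso (relOver k f f' h) := by
  have sq : IsPullback (relOver k f f' h) (relSnd f) (relSnd f') (M.map k.right) := by
    refine (IsPullback.of_bot ?_ (relOver_snd ..).symm (isPullback_rel f').flip).flip
    rw [relOver_fst, ← M.map_comp, ← Comma.comp_right, h]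
    exact (isPullback_rel f).flip
  exact sq.isIso_fst_of_isIso

variable [PreservesFiniteLimits M] {E B I J : Gl M} (p : E ⟶ B) {ev : I ⟶ pullback p p} {ev' : J ⟶ pullback p p}
  (k : I ⟶ J) (hk : k ≫ ev' = ev)

/-- The map of relative matching objects over `B` induced by a map over `E ×_B E`. -/
noncomputable def relBase : relObj (toBase p ev) ⟶ relObj (toBase p ev') :=
  relOver k (toBase p ev) (toBase p ev') (by rw [toBase, ← Category.assoc, hk])

lemma relBase_endLeft : relBase p k hk ≫ endLeft p ev' = endLeft p ev := by
  apply rel_hom_ext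
  · rw [Category.assoc, endLeft_fst, endLeft_fst, relBase, relOver_fst]
  · rw [Category.assoc, endLeft_snd, endLeft_snd, relBase, ← Category.assoc, relOver_snd,
      Category.assoc, ← M.map_comp, ← Comma.comp_right, ← Category.assoc, hk]

lemma relBase_endRight : relBase p k hk ≫ endRight p ev' = endRight p ev := by
  apply rel_hom_ext
  · rw [Category.assoc, endRight_fst, endRight_fst, relBase, relOver_fst]
  · rw [Category.assoc, endRight_snd, endRight_snd, relBase, ← Category.assoc, relOver_snd,
      Category.assoc, ← M.map_comp, ← Comma.comp_right, ← Category.assoc, hk]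

lemma relReflOf_relBase {r₀ : E.right ⟶ I.right} {r₀' : E.right ⟶ J.right}
    (h₀ : r₀ ≫ ev.right = (pullback.diagonal p).right)
    (h₀' : r₀' ≫ ev'.right = (pullback.diagonal p).right) (hr : r₀ ≫ k.right = r₀') :
    relReflOf p ev h₀ ≫ relBase p k hk = relReflOf p ev' h₀' := by
  apply rel_hom_ext
  · rw [Category.assoc, relBase, relOver_fst, relReflOf_fst, relReflOf_fst]
  · rw [Category.assoc, relBase, relOver_snd, relReflOf_snd_assoc, relReflOf_snd, ← M.map_comp, hr]

/-- The map between the pullbacks of `relMap p` along `endLeft` induced by a map over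
`E ×_B E`. -/
noncomputable def pullbackEndLeft :
    pullback (endLeft p ev) (relMap p) ⟶ pullback (endLeft p ev') (relMap p) :=
  pullback.lift (pullback.fst _ _ ≫ relBase p k hk) (pullback.snd _ _) (by
    rw [Category.assoc, relBase_endLeft, pullback.condition])

lemma pullbackEndLeft_fst : pullbackEndLeft p k hk ≫ pullback.fst _ _ =
    pullback.fst _ _ ≫ relBase p k hk :=
  pullback.lift_fst _ _ _

lemma pullbackEndLeft_snd : pullbackEndLeft p k hk ≫ pullback.snd _ _ = pullback.snd _ _ :=
  pullback.lift_snd _ _ _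

lemma relOver_matchLeft : relOver k ev ev' hk ≫ matchLeft p ev' =
    matchLeft p ev ≫ pullbackEndLeft p k hk := by
  apply pullback.hom_ext
  · rw [Category.assoc, Category.assoc, matchLeft_fst, pullbackEndLeft_fst, matchLeft_fst_assoc]
    apply rel_hom_ext
    · rw [Category.assoc, Category.assoc, downBase_fst, relBase, relOver_fst, downBase_fst,
        ← Category.assoc, relOver_fst]
    · rw [Category.assoc, Category.assoc, downBase_snd, relBase, relOver_snd, relOver_snd,
        ← Category.assoc (downBase p ev), downBase_snd]
  · rw [Category.assoc, Category.assoc, matchLeft_snd, pullbackEndLeft_snd, matchLeft_snd,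
      ← Category.assoc, relOver_fst]

variable {T₁ U₁ : C₁} {π₁ : T₁ ⟶ U₁} [ChosenPullbacksAlong π₁] (S₁ : PreIdStr π₁)
  (F₁ : FibStr π₁ (relMap p))

/-- The name of the identity type of `Q` depends only on the `E₁`-components of the two endpoints.
The right ones agree under `relOver`, and the left ones agree because the transports do. -/
lemma relOver_nameOf
    {tr : pullback (endLeft p ev) (relMap p) ⟶ pullback (endRight p ev) (relMap p)}
    {tr' : pullback (endLeft p ev') (relMap p) ⟶ pullback (endRight p ev') (relMap p)}
    (htr : tr ≫ pullback.snd _ _ = pullbackEndLeft p k hk ≫ tr' ≫ pullback.snd _ _)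
    {tw : relObj ev ⟶ pullback (pullback.fst (endRight p ev) (relMap p))
      (pullback.fst (endRight p ev) (relMap p))}
    (tw_fst : tw ≫ pullback.fst _ _ = matchLeft p ev ≫ tr)
    (tw_snd : tw ≫ pullback.snd _ _ = matchRight p ev)
    {tw' : relObj ev' ⟶ pullback (pullback.fst (endRight p ev') (relMap p))
      (pullback.fst (endRight p ev') (relMap p))}
    (tw_fst' : tw' ≫ pullback.fst _ _ = matchLeft p ev' ≫ tr')
    (tw_snd' : tw' ≫ pullback.snd _ _ = matchRight p ev') :
    relOver k ev ev' hk ≫ tw' ≫ S₁.nameOf (fibRight F₁ ev') =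
      tw ≫ S₁.nameOf (fibRight F₁ ev) := by
  have h : relOver k ev ev' hk ≫ tw' ≫ (fibRight F₁ ev').prodPoint =
      tw ≫ (fibRight F₁ ev).prodPoint := by
    apply pullback.hom_ext
    · simp only [FibStr.prodPoint, fibRight, FibStr.pull, Category.assoc, pullback.lift_fst,
        pullback.map]
      rw [reassoc_of% tw_fst, reassoc_of% tw_fst', reassoc_of% (relOver_matchLeft p k hk),
        reassoc_of% htr]
    · simp only [FibStr.prodPoint, fibRight, FibStr.pull, Category.assoc, pullback.lift_snd,
        pullback.map]
      rw [reassoc_of% tw_snd, reassoc_of% tw_snd', matchRight_snd_assoc, matchRight_snd_assoc,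
        ← Category.assoc, relOver_fst]
  rw [PreIdStr.nameOf_eq, PreIdStr.nameOf_eq, ← Category.assoc tw, ← h, Category.assoc,
    Category.assoc]

end Comparison

/-! ### Classification of the glued identity type by a map into the base of `τ`. -/

section Name

variable {C₀ : Type u₀} [Category.{v₀} C₀] [HasFiniteLimits C₀]
  {C₁ : Type u₁} [Category.{v₁} C₁] [HasFiniteLimits C₁] {M : C₀ ⥤ C₁} [PreservesFiniteLimits M]
  {T₀ U₀ : C₀} {π₀ : T₀ ⟶ U₀} [ChosenPullbacksAlong π₀] {T₁ U₁ : C₁} {π₁ : T₁ ⟶ U₁}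
  [ChosenPullbacksAlong π₁] (S₀ : IdStr π₀) (S₁ : IdStr π₁)
  {E B : Gl M} {p : E ⟶ B} (F₀ : FibStr π₀ p.right) (F₁ : FibStr π₁ (relMap p))

/-- The universal object over `E ×_B E` with 0-component the identity type of `p₀`. -/
noncomputable def idBase : Gl M where
  left := pullback (absMatch (pullback p p)) (M.map (S₀.ev F₀ ≫ inv (prodRight p)))
  right := S₀.obj F₀
  hom := pullback.snd _ _

/-- The 1-component of `idBase` is the relative matching object itself, so each object over `E ×_B
E` maps here as soon as its 0-component does. -/
noncomputable def idBaseEv : idBase S₀ F₀ ⟶ pullback p p where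
  left := pullback.fst _ _
  right := S₀.ev F₀ ≫ inv (prodRight p)
  w := pullback.condition

/-- The 0-component of `idBase`. -/
noncomputable def idBaseIso : (idBase S₀ F₀).right ≅ S₀.obj F₀ := Iso.refl _

lemma idBaseEv_right : (idBaseIso S₀ F₀).hom ≫ S₀.ev F₀ =
    (idBaseEv S₀ F₀).right ≫ prodRight p :=
  (Category.id_comp _).trans ((Category.comp_id _).symm.trans
    ((congrArg (S₀.ev F₀ ≫ ·) (IsIso.inv_hom_id (prodRight p)).symm).trans
      (Category.assoc _ _ _).symm))

variable (x : ExpStr (M.map π₀)) (x₀ : ExpStr π₀) (G₀ : FibStr π₀ (x₀.genComp π₀))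
  (L : LiftTransfer M π₀ π₁) (x₁ : ExpStr π₁) (G₁ : FibStr π₁ (x₁.genComp π₁))
  (P₁ : FibStr π₁ (x₁.polyMap π₁))

include G₀ L x₁ G₁ P₁ F₁ S₁ in
/-- The name of the identity type of a Reedy fibration. -/
lemma exists_idName : ∃ n : pullback p p ⟶ tauBase (U₁ := U₁) x,
    n.right = prodRight p ≫ S₀.nameOf F₀ ∧
    ∀ {I : Gl M} (a : I ⟶ tauTot x π₁) (ev : I ⟶ pullback p p), IsPullback a ev (tau x π₁) n →
      ∃ r : E ⟶ I, r.right ≫ a.right = F₀.point ≫ S₀.reflName ∧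
        Nonempty (IdFactorization S₀.toPreIdStr S₁.toPreIdStr p F₀ F₁ r ev) ∧
        Nonempty (LiftStr r.right (toBase p ev).right π₀) ∧
        Nonempty (LiftStr r.left (toBase p ev).left π₁) := by
  let ev' := idBaseEv S₀ F₀
  have hi' := idBaseEv_right S₀ F₀
  have h₀' := refl_comp_ev_right S₀ F₀ hi'
  -- Transport is built over `idBase`, since the name must be available before the object `I` that
  -- is pulled back along it.
  obtain ⟨tr', tr_over', tr_section'⟩ := exists_transport F₁
    (relReflOf_endLeft p ev' h₀') (relReflOf_endRight p ev' h₀') x₁ P₁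
    (liftRelRefl S₀ F₀ hi' x₀ G₀ L)
  let tw' : relObj ev' ⟶ pullback (pullback.fst (endRight p ev') (relMap p))
      (pullback.fst (endRight p ev') (relMap p)) :=
    pullback.lift (matchLeft p ev' ≫ tr') (matchRight p ev') (by
      rw [Category.assoc, tr_over', matchLeft_fst, matchRight_fst])
  have tw_fst' : tw' ≫ pullback.fst _ _ = matchLeft p ev' ≫ tr' := pullback.lift_fst _ _ _
  have tw_snd' : tw' ≫ pullback.snd _ _ = matchRight p ev' := pullback.lift_snd _ _ _
  let H := fibEvRight S₀ F₀ hi'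
  let N := tw' ≫ S₁.nameOf (fibRight F₁ ev')
  -- The level-1 name `N` on the relative matching object transposes across `M π₀`; together with
  -- the level-0 name it is a map of the gluing category.
  refine ⟨⟨x.polyLift (isPullback_relName H) N, H.name,
    x.polyLift_hom (isPullback_relName H) N⟩, rfl, ?_⟩
  intro I a ev sq
  have sqr : IsPullback a.right ev.right π₀ H.name := right_isPullback sq
  have sql : IsPullback a.left ev.left (x.genComp π₁) (x.polyLift (isPullback_relName H) N) :=
    left_isPullback sq
  -- Both 0-components are pullbacks of `π₀` along the same name.
  let i₀ : I.right ≅ S₀.obj F₀ := IsPullback.isoIsPullback _ _ sqr H.isPullback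
  have hpt : i₀.hom ≫ H.point = a.right := IsPullback.isoIsPullback_hom_fst _ _ _ _
  have hvar : i₀.hom ≫ S₀.var F₀ = a.right :=
    (congrArg (i₀.hom ≫ ·) (Category.id_comp (S₀.var F₀)).symm).trans hpt
  have hev : i₀.hom ≫ ev'.right = ev.right := IsPullback.isoIsPullback_hom_snd _ _ _ _
  have hi : i₀.hom ≫ S₀.ev F₀ = ev.right ≫ prodRight p :=
    (congrArg (i₀.hom ≫ ·) ((Category.id_comp _).symm.trans hi')).trans
      ((Category.assoc _ _ _).symm.trans (congrArg (· ≫ prodRight p) hev))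
  have h₀ := refl_comp_ev_right S₀ F₀ hi
  let k : I ⟶ idBase S₀ F₀ :=
    { left := pullback.lift ev.left (absMatch I ≫ M.map i₀.hom) (by
        rw [absMatch_w ev, Category.assoc, ← M.map_comp]
        exact congrArg (absMatch I ≫ M.map ·) hev.symm)
      right := i₀.hom
      w := pullback.lift_snd _ _ _ }
  have hk : k ≫ ev' = ev := CommaMorphism.ext (pullback.lift_fst _ _ _) hev
  have : IsIso k.right := inferInstanceAs (IsIso i₀.hom)
  have := isIso_relOver k ev ev' hk
  -- The relative matching objects over `I` and over `idBase` are identified by `k`, along which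
  -- transport is pulled back.
  obtain ⟨tr, tr_over, tr_section, htr⟩ := exists_transport_comp
    (relReflOf_endLeft p ev h₀) (relReflOf_endRight p ev h₀) tr_over' tr_section'
    (relBase_endRight p k hk)
    (relReflOf_relBase p k hk h₀ h₀' (by
      rw [Category.assoc]
      exact congrArg (S₀.refl F₀ ≫ ·) (i₀.inv_hom_id.trans rfl))) (pullbackEndLeft_fst p k hk)
    (pullbackEndLeft_snd p k hk)
  let tw : relObj ev ⟶ pullback (pullback.fst (endRight p ev) (relMap p))
      (pullback.fst (endRight p ev) (relMap p)) :=
    pullback.lift (matchLeft p ev ≫ tr) (matchRight p ev) (by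
      rw [Category.assoc, tr_over, matchLeft_fst, matchRight_fst])
  have tw_fst : tw ≫ pullback.fst _ _ = matchLeft p ev ≫ tr := pullback.lift_fst _ _ _
  have tw_snd : tw ≫ pullback.snd _ _ = matchRight p ev := pullback.lift_snd _ _ _
  have hN : relOver k ev ev' hk ≫ N = tw ≫ S₁.nameOf (fibRight F₁ ev) :=
    relOver_nameOf p k hk S₁.toPreIdStr F₁ htr tw_fst tw_snd tw_fst' tw_snd'
  -- Untransposing the 1-component of the pullback of `τ` shows `I₁` to be a pullback of `π₁` along
  -- `N`.
  have sqN : IsPullback (a.left ≫ pullback.snd (x.polyEv U₁) π₁)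
      (relMap ev ≫ relOver k ev ev' hk) π₁ N := by
    refine x.isPullback_of_genComp (isPullback_relName H) N sql ?_ ?_
    · rw [Category.assoc, relOver_fst, relMap_fst]
    · have h := absMatch_w a
      rw [← Category.assoc, Category.assoc _ _ (relSnd ev'), relOver_snd, ← Category.assoc,
        relMap_snd, Category.assoc, ← M.map_comp]
      exact (congrArg (absMatch I ≫ M.map ·) hpt).trans h.symm
  have sqE : IsPullback (a.left ≫ pullback.snd (x.polyEv U₁) π₁) (relMap ev) π₁
      (tw ≫ S₁.nameOf (fibRight F₁ ev)) := by
    rw [← hN]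
    exact IsPullback.of_iso sqN (Iso.refl _) (Iso.refl _) (asIso (relOver k ev ev' hk)).symm
      (Iso.refl _) (by simp) (by simp) (by simp) (by simp)
  let toId : I.left ⟶ S₁.obj (fibRight F₁ ev) :=
    (S₁.isPullback_ev (fibRight F₁ ev)).lift (a.left ≫ pullback.snd (x.polyEv U₁) π₁)
      (relMap ev ≫ tw) (by rw [sqE.w, Category.assoc])
  have sqI : IsPullback toId (relMap ev) (S₁.ev (fibRight F₁ ev)) tw :=
    IsPullback.of_right (by rw [IsPullback.lift_fst]; exact sqE) (IsPullback.lift_snd _ _ _ _)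
      (S₁.isPullback_ev (fibRight F₁ ev))
  obtain ⟨r, hr, hfac, hL⟩ := exists_idFactorization S₀ S₁ F₀ F₁ hi x₀ G₀ L x₁ G₁ P₁ tr_over
    tr_section tw_fst tw_snd sqI
  refine ⟨r, ?_, hfac, ⟨?_⟩, hL⟩
  · rw [hr, ← hvar, Category.assoc, i₀.inv_hom_id_assoc, PreIdStr.refl_var]
  · rw [hr]
    exact liftReflRight S₀ F₀ hi

end Name

/-! ### Assembly of the `Id`-type structure and of the factorizations. -/

section Main

variable {C₀ : Type u₀} [Category.{v₀} C₀] [HasFiniteLimits C₀]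
  {C₁ : Type u₁} [Category.{v₁} C₁] [HasFiniteLimits C₁] {M : C₀ ⥤ C₁} [PreservesFiniteLimits M]

lemma PreIdStr.nameOf_self {C : Type u} [Category.{v} C] [HasFiniteLimits C] {T U : C} {π : T ⟶ U}
    [ChosenPullbacksAlong π] (S : PreIdStr π) : S.nameOf (FibStr.self π) = S.Id := by
  have h : (FibStr.self π).prodPoint = 𝟙 (pullback π π) := by
    apply pullback.hom_ext
    · exact (pullback.lift_fst _ _ _).trans ((Category.comp_id _).trans (Category.id_comp _).symm)
    · exact (pullback.lift_snd _ _ _).trans ((Category.comp_id _).trans (Category.id_comp _).symm)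
  rw [nameOf_eq, h, Category.id_comp]

section

variable {V T : Gl M} {t : T ⟶ V} [ChosenPullbacksAlong t] [ChosenPullbacksAlong t.right]
  {S : PreIdStr t} {S₀ : PreIdStr t.right} (h : S.PreservedBySnd S₀)

/-- The lifting structure of the 0-component of the generic reflexivity map. -/
noncomputable def PreIdStr.PreservedBySnd.liftRight {T' V' : C₀} {π : T' ⟶ V'}
    (J : LiftStr S₀.genRefl (S₀.genEv ≫ pullback.fst t.right t.right ≫ t.right) π) :
    LiftStr S.genRefl.right (S.genEv ≫ pullback.fst t t ≫ t).right π :=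
  J.restrict (h.baseChange (BaseChange.refl _ _))

/-- The two base changes differ only by composition with identities, so naturality of `J` along
identity maps equates the fillers. This makes preservation of `J` strict. -/
lemma PreIdStr.PreservedBySnd.liftRight_fill {T' V' : C₀} {π : T' ⟶ V'}
    (J : LiftStr S₀.genRefl (S₀.genEv ≫ pullback.fst t.right t.right ≫ t.right) π)
    (c : BaseChange S.genRefl (S.genEv ≫ pullback.fst t t ≫ t)) (a : c.Y'.right ⟶ T')
    (b : c.E'.right ⟶ V') (w : a ≫ π = c.s'.right ≫ b) :
    (h.liftRight J).fill c.right a b w = J.fill (h.baseChange c) a b w := by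
  let φ : ((h.baseChange (BaseChange.refl _ _)).trans c.right).Hom (h.baseChange c) :=
    { t := 𝟙 _
      k := 𝟙 _
      l := 𝟙 _
      t_f := (Category.id_comp _).trans (Category.comp_id _).symm
      k_g := (Category.id_comp _).trans
        (congrArg (c.g.right ≫ ·) (Category.id_comp h.iso.hom).symm)
      l_h := (Category.id_comp _).trans (Category.comp_id _).symm
      k_e := (Category.id_comp _).trans (Category.comp_id _).symm
      l_s := (Category.id_comp _).trans (Category.comp_id _).symm }
  refine Eq.trans ?_ ((J.natural φ a b w).trans (Category.id_comp _))
  exact LiftStr.fill_congr J _ (Category.id_comp a).symm (Category.id_comp b).symm w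

end

/-- Identity types in the gluing category. -/
theorem gluedIdTypes {w₀ : UniversalMap C₀} {w₁ : UniversalMap C₁}
    (S₀ : TypeFormers w₀) (S₁ : TypeFormers w₁) (hM : Nonempty (ExpStr (M.map w₀.π)))
    (L : LiftTransfer M w₀.π w₁.π) : GluedIdTypes M w₀ w₁ S₀.id S₁.id where
  expo := hM
  universal e _ := by
    obtain ⟨n, hn, H⟩ := exists_idName S₀.id S₁.id (p := tau e w₁.π) (FibStr.self w₀.π)
      (tauFib e w₁.π) e w₀.str S₀.sigma L w₁.str S₁.sigma S₁.pi
    obtain ⟨r, hr, ⟨F⟩, ⟨-⟩, ⟨L₁⟩⟩ :=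
      H _ _ (ChosenPullbacksAlong.isPullback n (tau e w₁.π)).flip
    let P : PreIdStr (tau e w₁.π) :=
      { Id := n
        reflName := r ≫ ChosenPullbacksAlong.snd n (tau e w₁.π)
        comm := by
          rw [Category.assoc, ← ChosenPullbacksAlong.condition, ← Category.assoc, F.fac] }
    -- The chosen pullback determines a map by its two projections, and `reflName` was defined as
    -- the second projection of `r`.
    have hrefl : P.genRefl = r := P.isPullback_gen.hom_ext
      (P.genRefl_ev.trans F.fac.symm) P.genRefl_var
    have pre : PreIdStr.PreservedBySnd (t := tau e w₁.π) P S₀.id.toPreIdStr :=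
      { id_right := hn.trans (congrArg (prodRight (tau e w₁.π) ≫ ·) S₀.id.nameOf_self)
        reflName_right := hr.trans (Category.id_comp _) }
    have L₁' : LiftStr P.genRefl.left (toBase (tau e w₁.π) P.genEv).left w₁.π := by
      rw [hrefl]
      exact L₁
    let S : IdStr (tau e w₁.π) :=
      { toPreIdStr := P
        -- The 0-component is taken from the given `J` itself, so that the projection to `C₀`
        -- returns exactly that structure.
        J := gluedLift e (pre.liftRight S₀.id.J) L₁' }
    refine ⟨S, ⟨pre, fun c a b w =>
      pre.liftRight_fill S₀.id.J c a.right b.right (congrArg CommaMorphism.right w)⟩, ⟨?_⟩⟩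
    change IdFactorization _ _ _ _ _ P.genRefl _
    rw [hrefl]
    exact F
  factorization e E B p F₀ F₁ := by
    obtain ⟨n, -, H⟩ := exists_idName S₀.id S₁.id F₀ F₁ e w₀.str S₀.sigma L w₁.str S₁.sigma S₁.pi
    obtain ⟨r, -, hfac, ⟨L₀⟩, ⟨L₁⟩⟩ := H _ _ (IsPullback.of_hasPullback (tau e w₁.π) n)
    exact ⟨_, r, _, hfac, ⟨gluedLift e L₀ L₁⟩⟩

/-- Fibrations are exponentiable. -/
lemma UniversalMap.expStr_of_isFib {C : Type u} [Category.{v} C] [HasFiniteLimits C]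
    (w : UniversalMap C) {E B : C} {p : E ⟶ B} (h : IsFib w.π p) : Nonempty (ExpStr p) :=
  h.elim fun F => ⟨w.str.ofIsPullback F.isPullback⟩

end Main

end GlueId

theorem mainTheorem6
    {C₀ : Type*} [Category* C₀] [HasFiniteLimits C₀]
    {C₁ : Type*} [Category* C₁] [HasFiniteLimits C₁]
    (M : C₀ ⥤ C₁) [PreservesFiniteLimits M]
    (w₀ : GlueId.UniversalMap C₀) (w₁ : GlueId.UniversalMap C₁)
    (d₀ : GlueId.InternalUniverse w₀) (d₁ : GlueId.InternalUniverse w₁)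
    (S₀ : GlueId.TypeFormers w₀) (S₁ : GlueId.TypeFormers w₁)
    (D₀ : GlueId.TypeFormers d₀.toUniversalMap) (D₁ : GlueId.TypeFormers d₁.toUniversalMap)
    (hM : ∀ {E B : C₀} (p : E ⟶ B), GlueId.IsFib w₀.π p → GlueId.IsFib w₁.π (M.map p))
    (L : GlueId.LiftTransfer M w₀.π w₁.π) :
    GlueId.GluedIdTypes M w₀ w₁ S₀.id S₁.id ∧
      (GlueId.LiftTransfer M d₀.π d₁.π →
        GlueId.GluedIdTypes M d₀.toUniversalMap d₁.toUniversalMap D₀.id D₁.id) :=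
  ⟨GlueId.gluedIdTypes S₀ S₁ (w₁.expStr_of_isFib (hM w₀.π ⟨GlueId.FibStr.self w₀.π⟩)) L,
    -- The internal universe map of `C₀` is a `π₀`-fibration, so its image is a `π₁`-fibration and
    -- again exponentiable; no preservation of fibrations of the internal universes is needed.
    GlueId.gluedIdTypes D₀ D₁ (w₁.expStr_of_isFib (hM d₀.π ⟨d₀.fibMap⟩))⟩
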